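/- Let $q$ be a power of a prime, let $A=\mathbb{F}_q[t]$, let $K$ be a finite field extension of $\mathbb{F}_q(t)$, and let $\overline{K}$ be an algebraic closure of $K$. Let $K\{\tau\}$ be the ring of polynomials in $\tau$ over $K$ with $\tau c=c^q\tau$ for $c\in K$; the element $\sum_n c_n\tau^n$ acts on every field extension $L$ of $K$ by $x\mapsto\sum_n c_nx^{q^n}$. A Drinfeld module is a ring homomorphism $\phi:A\to K\{\tau\}$, $a\mapsto\phi_a$, such that for every $a\in A$ the coefficient of $\tau^0$ in $\phi_a$ is $a$, and such that $\phi_a\ne a\tau^0$ for some $a\in A$. Let $g$ be a positive integer and let $\phi_1,\dots,\phi_g:A\to K\{\tau\}$ be Drinfeld modules. For every field extension $L$ of $K$, let $A$ act on $\mathbb{G}_a^g(L)=L^g$ coordinatewise, by $a*(x_1,\dots,x_g)=((\phi_1)_a(x_1),\dots,(\phi_g)_a(x_g))$. A $\phi$-submodule is a subgroup that is invariant under this action. The rank of a $\phi$-submodule $\Gamma$ is $\dim_{\mathbb{F}_q(t)}\Gamma\otimes_A\mathbb{F}_q(t)$. An algebraic $\phi$-submodule of $\mathbb{G}_a^g$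 is an irreducible algebraic subgroup of $\mathbb{G}_a^g$ over $\overline{K}$ that is invariant under the action of $A$. **Theorem 4.1.** Let $V\subset\mathbb{G}_a^g$ be a closed affine subvariety defined over $K$ (the zero set in $\overline{K}^g$ of polynomials with coefficients in $K$, not necessarily irreducible). Let $\Gamma\subset\mathbb{G}_a^g(K)$ be a finitely generated $\phi$-submodule of rank $1$. Then $V(K)\cap\Gamma$ is a finite (possibly empty) union of cosets $\gamma+N$, with $\gamma\in\Gamma$ and $N$ a $\phi$-submodule of $\Gamma$. In particular, if $V$ is a curve that is irreducible over $K$ and $V$ is not a translate (by a point of $\mathbb{G}_a^g(\overline{K})$) of an algebraic $\phi$-submodule of $\mathbb{G}_a^g$, then $V(K)\cap\Gamma$ is finite. -/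

import Mathlib

open Polynomial

namespace DrinfeldML

noncomputable section

/-- The `q`-power Frobenius `x ↦ x ^ q`, `q = #Fq`, on a commutative ring `L` that receives a
ring homomorphism from the finite field `Fq`. -/
def frob {Fq : Type*} [Field Fq] [Finite Fq] {L : Type*} [CommRing L] (f : Fq →+* L) :
    L →+* L where
  toFun x := x ^ Nat.card Fq
  map_one' := one_pow _
  map_mul' x y := mul_pow x y _
  map_zero' := zero_pow Nat.card_pos.ne'
  map_add' x y := by
    let _ := Fintype.ofFinite Fq
    let _ := f.toAlgebra
    simpa [Nat.card_eq_fintype_card] using map_add (FiniteField.frobeniusAlgHom Fq L) x y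

lemma frob_pow_apply {Fq : Type*} [Field Fq] [Finite Fq] {L : Type*} [CommRing L]
    (f : Fq →+* L) (n : ℕ) (x : L) : (frob f ^ n) x = x ^ (Nat.card Fq ^ n) := by
  induction n with
  | zero => simp
  | succ n ih =>
    rw [pow_succ', RingHom.mul_def, RingHom.comp_apply, ih, pow_succ, pow_mul]
    rfl

/-- The `q`-power Frobenius as an additive endomorphism. -/
def frobEnd {Fq : Type*} [Field Fq] [Finite Fq] {L : Type*} [CommRing L] (f : Fq →+* L) :
    AddMonoid.End L :=
  (frob f).toAddMonoidHom

lemma frobEnd_pow_apply {Fq : Type*} [Field Fq] [Finite Fq] {L : Type*} [CommRing L]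
    (f : Fq →+* L) (n : ℕ) (x : L) : (frobEnd f ^ n) x = x ^ (Nat.card Fq ^ n) := by
  rw [AddMonoid.End.coe_pow, ← frob_pow_apply f, RingHom.coe_pow]
  rfl

section Twisted

variable (Fq : Type*) [Field Fq] [Finite Fq] (K : Type*) [Field K] [Algebra Fq[X] K]

/-- The structure map `Fq → K` of a field `K` which is an algebra over `A = Fq[t]`. -/
def constHom : Fq →+* K := (algebraMap Fq[X] K).comp C

/-- The action of `ℕ` on `K` through powers of the `q`-Frobenius. -/
abbrev frobAction : MulSemiringAction (Multiplicative ℕ) K :=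
  MulSemiringAction.compHom K (powersHom (K →+* K) (frob (constHom Fq K)))

/-- The ring `K{τ}` of polynomials in `τ`, with `τ * c = c ^ q * τ` for `c ∈ K`. -/
def TwistedPolynomial (_Fq : Type*) (K : Type*) [Field K] : Type _ :=
  SkewPolynomial K

instance : Ring (TwistedPolynomial Fq K) :=
  letI := frobAction Fq K
  inferInstanceAs (Ring (SkewPolynomial K))

variable {Fq K}

/-- The coefficient of `τ ^ n`. -/
def TwistedPolynomial.coeff (f : TwistedPolynomial Fq K) (n : ℕ) : K :=
  SkewPolynomial.coeff (R := K) f n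

variable (Fq) in
/-- The constant twisted polynomial `c τ ^ 0`. -/
def TwistedPolynomial.const (c : K) : TwistedPolynomial Fq K :=
  (SkewPolynomial.C c : SkewPolynomial K)

/-- Twisted polynomials as additive maps on a field extension `L` of `K`
(addition is pointwise, multiplication is composition of maps):
`∑ cₙ τⁿ` acts as `x ↦ ∑ cₙ x ^ (q ^ n)`, see `TwistedPolynomial.toEnd_apply`. -/
def TwistedPolynomial.toEnd (L : Type*) [Field L] [Algebra K L] :
    TwistedPolynomial Fq K →+* AddMonoid.End L :=
  letI := frobAction Fq K
  SkewMonoidAlgebra.liftNCRingHom (k := K) (G := Multiplicative ℕ)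
    (Module.toAddMonoidEnd K L)
    (powersHom (AddMonoid.End L) (frobEnd ((algebraMap K L).comp (constHom Fq K))))
    (by
      intro c n
      ext x
      have h : n • c = c ^ (Nat.card Fq ^ n.toAdd) := frob_pow_apply (constHom Fq K) n.toAdd c
      change (n • c) • (frobEnd ((algebraMap K L).comp (constHom Fq K)) ^ n.toAdd) x =
        (frobEnd ((algebraMap K L).comp (constHom Fq K)) ^ n.toAdd) (c • x)
      rw [h, frobEnd_pow_apply, frobEnd_pow_apply, Algebra.smul_def, Algebra.smul_def, map_pow,
        mul_pow])

lemma TwistedPolynomial.toEnd_apply (L : Type*) [Field L] [Algebra K L]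
    (f : TwistedPolynomial Fq K) (x : L) :
    TwistedPolynomial.toEnd L f x =
      SkewPolynomial.sum (R := K) f fun n c ↦ algebraMap K L c * x ^ (Nat.card Fq ^ n) := by
  let _ := frobAction Fq K
  refine SkewPolynomial.induction (R := K)
    (motive := fun f ↦ TwistedPolynomial.toEnd (Fq := Fq) L f x =
      SkewPolynomial.sum (R := K) f fun n c ↦ algebraMap K L c * x ^ (Nat.card Fq ^ n)) f ?_ ?_
  · exact (congrArg (fun e : AddMonoid.End L ↦ e x)
      (map_zero (TwistedPolynomial.toEnd (Fq := Fq) (K := K) L)))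
  · intro n c p _ _ ih
    have e1 : TwistedPolynomial.toEnd (Fq := Fq) L
        (SkewPolynomial.monomial n c : SkewPolynomial K) x =
          algebraMap K L c * x ^ (Nat.card Fq ^ n) := by
      rw [← frobEnd_pow_apply ((algebraMap K L).comp (constHom Fq K)), ← Algebra.smul_def]
      exact congrArg (fun e : AddMonoid.End L ↦ e x)
        (SkewMonoidAlgebra.liftNC_single (Module.toAddMonoidEnd K L : K →+ AddMonoid.End L)
          (powersHom (AddMonoid.End L) (frobEnd ((algebraMap K L).comp (constHom Fq K))))
          (Multiplicative.ofAdd n) c)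
    have e2 : SkewPolynomial.sum (R := K) (SkewPolynomial.monomial n c + p)
        (fun n c ↦ algebraMap K L c * x ^ (Nat.card Fq ^ n)) =
        algebraMap K L c * x ^ (Nat.card Fq ^ n) +
          SkewPolynomial.sum (R := K) p
            fun n c ↦ algebraMap K L c * x ^ (Nat.card Fq ^ n) := by
      rw [SkewPolynomial.sum_def', SkewMonoidAlgebra.sum_add_index'
        (fun _ ↦ by rw [map_zero, zero_mul])
        (fun _ _ _ ↦ by rw [map_add, add_mul])]
      congr 1
      exact SkewPolynomial.sum_monomial_index (h := fun n c ↦ algebraMap K L c * x ^ (Nat.card Fq ^ n))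
        (by rw [map_zero, zero_mul])
    rw [e2, ← e1, ← ih]
    exact (congrArg (fun e : AddMonoid.End L ↦ e x)
      (map_add (TwistedPolynomial.toEnd (Fq := Fq) (K := K) L) _ _))

end Twisted

/-- A Drinfeld module (of generic characteristic) `φ : A → K{τ}` for `A = Fq[t]`, where `K` is a
field and an `A`-algebra. -/
structure DrinfeldModule (Fq : Type*) [Field Fq] [Finite Fq] (K : Type*) [Field K]
    [Algebra Fq[X] K] where
  toRingHom : Fq[X] →+* TwistedPolynomial Fq K
  coeff_zero : ∀ a : Fq[X], (toRingHom a).coeff 0 = algebraMap Fq[X] K a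
  nontrivial : ∃ a : Fq[X], toRingHom a ≠ TwistedPolynomial.const Fq (algebraMap Fq[X] K a)

section Points

variable {Fq : Type*} [Field Fq] [Finite Fq] {K : Type*} [Field K] [Algebra Fq[X] K] {g : ℕ}

/-- The group `𝔾ₐᵍ(L) = Lᵍ`, to be equipped with the coordinatewise action of
`φ = (φ₁, …, φ_g)`. -/
def Points (_φ : Fin g → DrinfeldModule Fq K) (L : Type*) : Type _ := Fin g → L

variable (φ : Fin g → DrinfeldModule Fq K) (L : Type*) [Field L] [Algebra K L]

instance : AddCommGroup (Points φ L) := inferInstanceAs (AddCommGroup (Fin g → L))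

/-- The `A`-module structure `a • (x₁, …, x_g) = ((φ₁)_a(x₁), …, (φ_g)_a(x_g))` on `Lᵍ`.
A `φ`-submodule of `Lᵍ` is an `A`-submodule for this structure. -/
instance : Module Fq[X] (Points φ L) where
  smul a x := fun i ↦ TwistedPolynomial.toEnd L ((φ i).toRingHom a) (x i)
  one_smul x := funext fun i ↦ by
    change TwistedPolynomial.toEnd L ((φ i).toRingHom 1) (x i) = x i
    simp
  mul_smul a b x := funext fun i ↦ by
    change TwistedPolynomial.toEnd L ((φ i).toRingHom (a * b)) (x i) =
      TwistedPolynomial.toEnd L ((φ i).toRingHom a)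
        (TwistedPolynomial.toEnd L ((φ i).toRingHom b) (x i))
    simp
  smul_zero a := funext fun i ↦
    map_zero (TwistedPolynomial.toEnd L ((φ i).toRingHom a))
  smul_add a x y := funext fun i ↦
    map_add (TwistedPolynomial.toEnd L ((φ i).toRingHom a)) (x i) (y i)
  add_smul a b x := funext fun i ↦
    congrArg (fun e : AddMonoid.End L ↦ e (x i))
      ((congrArg _ (map_add (φ i).toRingHom a b)).trans (map_add (TwistedPolynomial.toEnd L) _ _))
  zero_smul x := funext fun i ↦ by
    change TwistedPolynomial.toEnd L ((φ i).toRingHom 0) (x i) = 0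
    simp

lemma Points.smul_apply (a : Fq[X]) (x : Points φ L) (i : Fin g) :
    (a • x) i = TwistedPolynomial.toEnd L ((φ i).toRingHom a) (x i) := rfl

end Points

section Modules

open scoped TensorProduct

/-- The rank `dim_{Fq(t)} (Γ ⊗_A Fq(t))` of an `A`-module `Γ`, `A = Fq[t]`. -/
def phiRank (Fq : Type*) [Field Fq] (Γ : Type*) [AddCommGroup Γ] [Module Fq[X] Γ] : Cardinal :=
  Module.rank (RatFunc Fq) (RatFunc Fq ⊗[Fq[X]] Γ)

/-- `S` is a finite union (possibly empty) of cosets of `R`-submodules of `Γ`. -/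
def IsFiniteUnionOfCosets {R M : Type*} [Ring R] [AddCommGroup M] [Module R M]
    (Γ : Submodule R M) (S : Set M) : Prop :=
  ∃ (n : ℕ) (γ : Fin n → M) (N : Fin n → Submodule R M),
    (∀ i, γ i ∈ Γ ∧ N i ≤ Γ) ∧ S = ⋃ i, (fun y ↦ γ i + y) '' (N i : Set M)

end Modules

section Geometry

/-- `V ⊆ Lᵍ` is an algebraic set defined over the subfield `k`: the set of common zeros of an
ideal of `k[X₁, …, X_g]`. -/
def IsAlgebraicSet (k : Type*) [Field k] {L : Type*} [Field L] [Algebra k L] {g : ℕ}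
    (V : Set (Fin g → L)) : Prop :=
  ∃ I : Ideal (MvPolynomial (Fin g) k), V = MvPolynomial.zeroLocus L I

/-- The algebraic set `V ⊆ Lᵍ` (`L` algebraically closed) is irreducible as a variety over `k`,
i.e. its coordinate ring over `k` is a domain. -/
def IsIrreducibleOver (k : Type*) [Field k] {L : Type*} [Field L] [Algebra k L] {g : ℕ}
    (V : Set (Fin g → L)) : Prop :=
  IsAlgebraicSet k V ∧ (MvPolynomial.vanishingIdeal k V).IsPrime

/-- `V` is an irreducible curve over `k`: irreducible, and its coordinate ring has dimension one. -/
def IsIrreducibleCurve (k : Type*) [Field k] {L : Type*} [Field L] [Algebra k L] {g : ℕ}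
    (V : Set (Fin g → L)) : Prop :=
  IsIrreducibleOver k V ∧
    ringKrullDim (MvPolynomial (Fin g) k ⧸ MvPolynomial.vanishingIdeal k V) = 1

variable {Fq : Type*} [Field Fq] [Finite Fq] {K : Type*} [Field K] [Algebra Fq[X] K] {g : ℕ}
  (φ : Fin g → DrinfeldModule Fq K) {L : Type*} [Field L] [Algebra K L]

/-- The `K`-rational points of an algebraic set `V ⊆ Lᵍ`, for `L` an extension of `K`. -/
def rationalPoints (V : Set (Fin g → L)) : Set (Points φ K) :=
  {x | (fun i ↦ algebraMap K L (x i)) ∈ V}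

/-- `B ⊆ Lᵍ` (`L` an algebraic closure of `K`) is an algebraic `φ`-submodule of `𝔾ₐᵍ`: an
irreducible algebraic subgroup which is invariant under the action of `φ`. -/
def IsAlgebraicSubmodule (B : Submodule Fq[X] (Points φ L)) : Prop :=
  IsIrreducibleOver L (B : Set (Points φ L))

/-- `V` is a translate, by a point of `Lᵍ`, of an algebraic `φ`-submodule of `𝔾ₐᵍ`. -/
def IsTranslateOfAlgebraicSubmodule (V : Set (Fin g → L)) : Prop :=
  ∃ (B : Submodule Fq[X] (Points φ L)) (x : Points φ L),
    IsAlgebraicSubmodule φ B ∧ V = (fun y ↦ x + y) '' (B : Set (Points φ L))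

end Geometry

end

end DrinfeldML

open DrinfeldML

/-! This is a Strassmann argument at a well-chosen prime of `A = Fq[t]`. Take an irreducible `P`
prime to a common denominator of the data, and a valuation ring `O` of `Kbar` dominating `A` at `P`.
Comparing coefficients in φ_t φ_a = φ_a φ_t shows that the coefficient of τ^n in φ_a is a polynomial
in `a` with denominator at most P^(q^n - 1) (`DrinfeldModule.exists_coeff_polynomial`). So if γ is
divisible by P^2, the map a ↦ φ_a(γ) is a `P`-adic limit of polynomials over `O`; by pigeonhole
modulo P^2, every point has a nonzero multiple of this kind (`exists_smul_dvd_sq`). Hence a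
polynomial has finitely many zeros b ↦ δ + bγ on a coset of Aγ or vanishes on all of it
(`exists_smul_eval_eq_zero_of_infinite`).

Rank one gives such an Aγ of finite index in Γ, so Γ splits into finitely many cosets, each meeting
`V` in a finite set or contained in `V`. If an irreducible curve contains one of them, dimension
forces it to be the Zariski closure of that coset, a translate of the closure of Aγ. This closure is
an `A`-stable group, and it is irreducible: if a product vanishes on Aγ, one factor has infinitely
many zeros there, hence vanishes (`isTranslate_of_orbit_subset`). -/

namespace DrinfeldML

noncomputable section

/-! ### Strassmann's theorem over a valuation ring, without completeness. -/

section Strassmann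

variable {O : Type*} [CommRing O] [IsDomain O] [ValuationRing O]

lemma exists_dvd_forall_of_valuationRing (f : ℕ → O) {s : Finset ℕ} (hs : s.Nonempty) :
    ∃ i ∈ s, ∀ j ∈ s, f i ∣ f j := by
  induction hs using Finset.Nonempty.cons_induction with
  | singleton a => exact ⟨a, by simp, by simp⟩
  | cons a s h hs ih =>
    obtain ⟨i, hi, hij⟩ := ih
    rcases ValuationRing.dvd_total (f a) (f i) with h1 | h1
    · refine ⟨a, by simp, fun j hj ↦ ?_⟩
      rcases Finset.mem_cons.mp hj with rfl | hj
      · rfl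
      · exact h1.trans (hij j hj)
    · refine ⟨i, by simp [hi], fun j hj ↦ ?_⟩
      rcases Finset.mem_cons.mp hj with rfl | hj
      · exact h1
      · exact hij j hj

/-- Over a valuation ring, a nonzero polynomial is a constant times a polynomial with some
coefficient equal to one. -/
lemma exists_eq_C_mul_primitive {F : O[X]} (hF : F ≠ 0) :
    ∃ (ρ : O) (H : O[X]), F = C ρ * H ∧ ∃ i, H.coeff i = 1 := by
  obtain ⟨i, hi, hij⟩ := exists_dvd_forall_of_valuationRing F.coeff
    (Polynomial.support_nonempty.mpr hF)
  have hd : C (F.coeff i) ∣ F := by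
    rw [C_dvd_iff_dvd_coeff]
    intro j
    by_cases hj : j ∈ F.support
    · exact hij j hj
    · rw [notMem_support_iff.mp hj]; exact dvd_zero _
  obtain ⟨H, hH⟩ := hd
  refine ⟨_, H, hH, i, ?_⟩
  have h := congrArg (fun p ↦ coeff p i) hH
  simp only [coeff_C_mul] at h
  exact (mul_right_eq_self₀.mp h.symm).resolve_right (mem_support_iff.mp hi)

/-- A polynomial over a valuation ring which has more than `N` roots, and whose coefficients in
degrees larger than `N` are divisible by `p`, is divisible by `p`. -/
lemma C_dvd_of_card_roots_lt {F : O[X]} {p : O} {N : ℕ}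
    (hF : ∀ i, N < i → p ∣ F.coeff i) (S : Finset O) (hS : N < S.card)
    (hroot : ∀ z ∈ S, F.eval z = 0) : C p ∣ F := by
  by_cases hF0 : F = 0
  · rw [hF0]; exact dvd_zero _
  obtain ⟨ρ, H, rfl, i, hi⟩ := exists_eq_C_mul_primitive hF0
  have hρ : ρ ≠ 0 := by rintro rfl; simp at hF0
  rw [C_dvd_iff_dvd_coeff]
  suffices hd : p ∣ ρ by intro j; rw [coeff_C_mul]; exact hd.mul_right _
  by_contra hd
  -- If `p` does not divide the content `ρ`, no coefficient of `H` beyond `N` is a unit, so `H`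
  -- reduces to a nonzero polynomial of degree at most `N`.
  have hm : ∀ i, N < i → H.coeff i ∈ IsLocalRing.maximalIdeal O := by
    intro i hi
    rw [IsLocalRing.mem_maximalIdeal, mem_nonunits_iff]
    intro hu
    have := hF i hi
    rw [coeff_C_mul, hu.dvd_mul_right] at this
    exact hd this
  have hH0 : H ≠ 0 := by rintro rfl; simp at hi
  -- The linear factors are split off before reduction, since distinct roots may collide in the
  -- residue field; their monic product keeps its degree.
  have hdvd : ∏ z ∈ S, (X - C z) ∣ H := by
    refine (Multiset.prod_X_sub_C_dvd_iff_le_roots hH0 S.val).mpr ?_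
    refine (Multiset.le_iff_subset S.nodup).mpr fun z hz ↦ ?_
    rw [mem_roots hH0, IsRoot.def]
    have := hroot z hz
    rw [eval_mul, eval_C] at this
    exact (mul_eq_zero.mp this).resolve_left hρ
  obtain ⟨G, hG⟩ := hdvd
  set π := IsLocalRing.residue O
  have hne : H.map π ≠ 0 := fun h ↦ by
    have := congrArg (fun p ↦ coeff p i) h
    simp [coeff_map, hi] at this
  have hmon : (∏ z ∈ S, (X - C z)).Monic := monic_prod_of_monic _ _ fun z _ ↦ monic_X_sub_C z
  have hdeg : (H.map π).natDegree ≤ N := by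
    rw [natDegree_le_iff_coeff_eq_zero]
    intro j hj
    rw [coeff_map]
    exact (IsLocalRing.residue_eq_zero_iff _).mpr (hm j hj)
  rw [hG, Polynomial.map_mul] at hne hdeg
  have hGne : G.map π ≠ 0 := right_ne_zero_of_mul hne
  rw [(hmon.map π).natDegree_mul' hGne, hmon.natDegree_map, natDegree_prod_of_monic _ _
    fun z _ ↦ monic_X_sub_C z] at hdeg
  simp at hdeg
  omega

/-- A form of Strassmann's theorem: an adic limit of polynomials with infinitely many zeros
vanishes. -/
lemma eventually_eval_eq_zero_of_infinite {π : O} (hsep : ∀ x : O, (∀ n, π ^ n ∣ x) → x = 0)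
    (F : ℕ → O[X]) (hF : ∀ k j, k ≤ j → C (π ^ k) ∣ F j - F k)
    {Z : Set O} (hZ : Z.Infinite) (hroot : ∀ z ∈ Z, ∀ᶠ k in Filter.atTop, (F k).eval z = 0)
    {w c : O} (hw : ∀ᶠ k in Filter.atTop, (F k).eval w = c) : c = 0 := by
  refine hsep c fun m ↦ ?_
  -- The degrees of the `F k` may be unbounded, but modulo `π ^ m` all later ones agree with `F m`,
  -- so one zero more than its degree suffices.
  obtain ⟨S, hSZ, hS⟩ := hZ.exists_subset_card_eq ((F m).natDegree + 1)
  have h1 : ∀ᶠ k in Filter.atTop, ∀ z ∈ S, (F k).eval z = 0 :=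
    (Filter.eventually_all_finset S).mpr fun z hz ↦ hroot z (hSZ hz)
  obtain ⟨k, ⟨hk1, hk2⟩, hk3⟩ := ((h1.and hw).and (Filter.eventually_ge_atTop m)).exists
  have hd : C (π ^ m) ∣ F k := by
    refine C_dvd_of_card_roots_lt (N := (F m).natDegree) (fun i hi ↦ ?_) S (by omega) hk1
    have := (C_dvd_iff_dvd_coeff _ _).mp (hF m k hk3) i
    rwa [coeff_sub, coeff_eq_zero_of_natDegree_lt hi, sub_zero] at this
  obtain ⟨G, hG⟩ := hd
  rw [← hk2, hG, eval_mul, eval_C]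
  exact dvd_mul_right _ _

end Strassmann

/-! ### Coefficients of twisted polynomials. -/

section TwistedCoeff

variable {Fq : Type*} [Field Fq] [Finite Fq] {K : Type*} [Field K] [Algebra Fq[X] K]

lemma TwistedPolynomial.coeff_mul (f g : TwistedPolynomial Fq K) (n : ℕ) :
    (f * g).coeff n =
      ∑ p ∈ Finset.HasAntidiagonal.antidiagonal n, f.coeff p.1 * g.coeff p.2 ^ (Nat.card Fq ^ p.1) := by
  let _ := frobAction Fq K
  have h := SkewMonoidAlgebra.coeff_mul_antidiagonal_of_finset (k := K) (G := Multiplicative ℕ) f g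
    (Multiplicative.ofAdd n) (((Finset.HasAntidiagonal.antidiagonal n).map
      (Equiv.prodCongr Multiplicative.ofAdd Multiplicative.ofAdd).toEmbedding)) (by
        rintro ⟨a, b⟩
        rw [Finset.mem_map_equiv, Finset.HasAntidiagonal.mem_antidiagonal]
        rfl)
  rw [Finset.sum_map] at h
  refine h.trans (Finset.sum_congr rfl fun p _ ↦ ?_)
  congr 1
  exact frob_pow_apply (constHom Fq K) p.1 _

/-- The truncation length stays free above `N`, so that several expansions can be cut at a common
length. -/
lemma TwistedPolynomial.exists_forall_toEnd_eq_sum (L : Type*) [Field L] [Algebra K L]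
    (f : TwistedPolynomial Fq K) : ∃ N, ∀ k, N ≤ k → ∀ x : L, TwistedPolynomial.toEnd L f x =
      ∑ n ∈ Finset.range k, algebraMap K L (f.coeff n) * x ^ (Nat.card Fq ^ n) := by
  refine ⟨(SkewPolynomial.support (R := K) f).sup id + 1, fun k hk x ↦ ?_⟩
  refine (TwistedPolynomial.toEnd_apply L f x).trans ((SkewPolynomial.sum_def (R := K) _ _).trans ?_)
  refine Finset.sum_subset (fun n hn ↦ ?_) (fun n _ hn ↦ ?_)
  · have := Finset.le_sup (f := id) hn
    simp only [id] at this
    exact Finset.mem_range.mpr (by omega)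
  · rw [SkewPolynomial.notMem_support_iff (R := K) |>.mp hn, map_zero, zero_mul]

/-- The commutation `φ_t φ_a = φ_a φ_t`, read off on coefficients. -/
lemma DrinfeldModule.coeff_succ_recursion (φ : DrinfeldModule Fq K) (a : Fq[X]) (m : ℕ) :
    algebraMap Fq[X] K (X - X ^ (Nat.card Fq ^ (m + 1))) * (φ.toRingHom a).coeff (m + 1) =
      ∑ i ∈ Finset.range (m + 1),
        ((φ.toRingHom a).coeff i * (φ.toRingHom X).coeff (m + 1 - i) ^ (Nat.card Fq ^ i) -
          (φ.toRingHom X).coeff (i + 1) *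
            (φ.toRingHom a).coeff (m - i) ^ (Nat.card Fq ^ (i + 1))) := by
  have h : (φ.toRingHom X * φ.toRingHom a).coeff (m + 1) =
      (φ.toRingHom a * φ.toRingHom X).coeff (m + 1) := by
    rw [← map_mul, ← map_mul, mul_comm]
  -- The first term of φ_t φ_a and the last term of φ_a φ_t are the only ones containing the top
  -- coefficient of φ_a; together they give the factor t - t^(q^(m+1)).
  rw [TwistedPolynomial.coeff_mul, TwistedPolynomial.coeff_mul,
    Finset.Nat.sum_antidiagonal_eq_sum_range_succ_mk, Finset.Nat.sum_antidiagonal_eq_sum_range_succ_mk,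
    Finset.sum_range_succ', Finset.sum_range_succ _ (m + 1)] at h
  simp only [Nat.sub_self, φ.coeff_zero, pow_zero, pow_one, Nat.sub_zero,
    Nat.add_sub_add_right] at h
  rw [Finset.sum_sub_distrib, map_sub, map_pow]
  linear_combination h

end TwistedCoeff

/-! ### Denominators of the coefficients of φ_a as polynomials in `a`. -/

section IntegralCoeff

variable {Fq : Type*} [Field Fq] [Finite Fq]

lemma two_le_card (F : Type*) [Field F] [Finite F] : 2 ≤ Nat.card F := Finite.one_lt_card

variable {O : Type*} [CommRing O] [IsDomain O] [ValuationRing O] [Algebra Fq[X] O]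

omit [Finite Fq] in
-- In a Bézout relation uP + va = 1 one summand is a unit of the local ring `O`, and it cannot be
-- uP.
lemma isUnit_algebraMap_of_not_dvd {P : Fq[X]} (hP : Irreducible P)
    (hPO : ¬ IsUnit (algebraMap Fq[X] O P)) {a : Fq[X]} (ha : ¬ P ∣ a) :
    IsUnit (algebraMap Fq[X] O a) := by
  obtain ⟨u, v, h⟩ := (hP.coprime_iff_not_dvd).mpr ha
  have h' := congrArg (algebraMap Fq[X] O) h
  rw [map_add, map_mul, map_mul, map_one] at h'
  rcases IsLocalRing.isUnit_or_isUnit_of_add_one h' with h1 | h1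
  · exact absurd (isUnit_of_mul_isUnit_right h1) hPO
  · exact isUnit_of_mul_isUnit_right h1

lemma squarefree_X_sub_X_pow_card_pow {n : ℕ} (hn : n ≠ 0) :
    Squarefree (X - X ^ (Nat.card Fq ^ n) : Fq[X]) := by
  have := Fintype.ofFinite Fq
  obtain ⟨p, hp⟩ := CharP.exists Fq
  have hs : (X ^ (Nat.card Fq ^ n) - X : Fq[X]).Separable := by
    refine galois_poly_separable p _ (dvd_pow ?_ hn)
    rw [Nat.card_eq_fintype_card, ← CharP.cast_eq_zero_iff Fq p]
    exact Nat.cast_card_eq_zero Fq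
  exact (Associated.squarefree_iff ⟨-1, by simp⟩).mp hs.squarefree

/-- By squarefreeness `P` divides t - t^(q^n) at most once, so each division in the recursion costs
at most one factor `P`. -/
lemma exists_mul_algebraMap_X_sub_X_pow {P : Fq[X]} (hP : Irreducible P)
    (hPO : ¬ IsUnit (algebraMap Fq[X] O P)) {n : ℕ} (hn : n ≠ 0) :
    ∃ w : O, w * algebraMap Fq[X] O (X - X ^ (Nat.card Fq ^ n)) = algebraMap Fq[X] O P := by
  by_cases h : P ∣ X - X ^ (Nat.card Fq ^ n)
  · obtain ⟨b, hb⟩ := h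
    have hPb : ¬ P ∣ b := by
      rintro ⟨c, rfl⟩
      refine hP.not_isUnit (squarefree_X_sub_X_pow_card_pow (Fq := Fq) hn P ⟨c, ?_⟩)
      rw [hb, mul_assoc]
    obtain ⟨u, hu⟩ := isUnit_algebraMap_of_not_dvd (O := O) hP hPO hPb
    refine ⟨↑u⁻¹, ?_⟩
    rw [hb, map_mul, ← hu, mul_comm, mul_assoc, Units.mul_inv, mul_one]
  · obtain ⟨u, hu⟩ := isUnit_algebraMap_of_not_dvd (O := O) hP hPO h
    exact ⟨algebraMap Fq[X] O P * ↑u⁻¹, by rw [← hu, mul_assoc, Units.inv_mul, mul_one]⟩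

variable {K : Type*} [Field K] [Algebra Fq[X] K] {L : Type*} [Field L] [Algebra K L]
  [Algebra Fq[X] L] [IsScalarTower Fq[X] K L] [Algebra O L] [IsScalarTower Fq[X] O L]

/-- The coefficient of `τ ^ n` in `φ_a` is, up to the denominator `P ^ (q ^ n - 1)`, an integral
polynomial in `a`. -/
lemma DrinfeldModule.exists_coeff_polynomial (φ : DrinfeldModule Fq K) {P : Fq[X]}
    (hP : Irreducible P) (hPO : ¬ IsUnit (algebraMap Fq[X] O P)) (α : ℕ → O)
    (hα : ∀ i, algebraMap O L (α i) = algebraMap K L ((φ.toRingHom X).coeff i)) (n : ℕ) :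
    ∃ D : O[X], ∀ a : Fq[X], algebraMap O L (D.eval (algebraMap Fq[X] O a)) =
      algebraMap Fq[X] L P ^ (Nat.card Fq ^ n - 1) *
        algebraMap K L ((φ.toRingHom a).coeff n) := by
  induction n using Nat.strong_induction_on with
  | _ n ih =>
  rcases n with _ | m
  · refine ⟨X, fun a ↦ ?_⟩
    simp only [eval_X, pow_zero, Nat.sub_self, one_mul, φ.coeff_zero,
      ← IsScalarTower.algebraMap_apply]
  · choose! D hD using ih
    obtain ⟨w, hw⟩ := exists_mul_algebraMap_X_sub_X_pow (O := O) hP hPO (Nat.succ_ne_zero m)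
    set q := Nat.card Fq with hq
    have hq2 : 2 ≤ q := two_le_card Fq
    set p : O := algebraMap Fq[X] O P with hp
    have hpL : algebraMap O L p = algebraMap Fq[X] L P :=
      (IsScalarTower.algebraMap_apply Fq[X] O L P).symm
    have hwL : algebraMap O L w * algebraMap K L (algebraMap Fq[X] K (X - X ^ (q ^ (m + 1)))) =
        algebraMap Fq[X] L P := by
      rw [← IsScalarTower.algebraMap_apply, IsScalarTower.algebraMap_apply Fq[X] O L, ← map_mul]
      rw [hw, ← hpL]
    -- One of the q^(m+1) - 1 factors `P` pays for dividing by t - t^(q^(m+1)). The other q^(m+1) -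
    -- 2 cover the denominators q^i - 1 of `D i` and q^(m+1) - q^(i+1) of `D (m - i) ^ (q ^ (i +
    -- 1))`; the exponents of `p` shown here are what is left over.
    refine ⟨C w * ∑ i ∈ Finset.range (m + 1),
      (C (p ^ (q ^ (m + 1) - 2 - (q ^ i - 1)) * α (m + 1 - i) ^ (q ^ i)) * D i -
        C (p ^ (q ^ (i + 1) - 2) * α (i + 1)) * D (m - i) ^ (q ^ (i + 1))), fun a ↦ ?_⟩
    have hpos : 2 ≤ q ^ (m + 1) := hq2.trans (Nat.le_self_pow (Nat.succ_ne_zero m) q)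
    have e1 : algebraMap Fq[X] L P ^ (q ^ (m + 1) - 1) =
        algebraMap Fq[X] L P ^ (q ^ (m + 1) - 2) * (algebraMap O L w *
          algebraMap K L (algebraMap Fq[X] K (X - X ^ (q ^ (m + 1))))) := by
      rw [hwL, ← pow_succ]; congr 1; omega
    have key := congrArg (algebraMap K L) (φ.coeff_succ_recursion a m)
    rw [map_mul, map_sum] at key
    rw [eval_mul, eval_C, eval_finsetSum, map_mul, map_sum, e1]
    have e0 : ∀ x y z u : L, x * (y * z) * u = y * (x * (z * u)) := fun _ _ _ _ ↦ by ring
    rw [e0, key]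
    congr 1
    rw [Finset.mul_sum]
    refine Finset.sum_congr rfl fun i hi ↦ ?_
    have hi' : i < m + 1 := Finset.mem_range.mp hi
    have h1 : q ^ i * 2 ≤ q ^ (m + 1) :=
      (Nat.mul_le_mul_left _ hq2).trans ((pow_succ q i).symm.le.trans
        (Nat.pow_le_pow_right (by omega) (by omega)))
    have h1' : 1 ≤ q ^ i := Nat.one_le_pow _ _ (by omega)
    have h2 : q ^ (m - i) * q ^ (i + 1) = q ^ (m + 1) := by
      rw [← pow_add]; congr 1; omega
    have h3 : 2 ≤ q ^ (i + 1) := hq2.trans (Nat.le_self_pow (Nat.succ_ne_zero i) q)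
    have h4 : q ^ (i + 1) ≤ q ^ (m + 1) := Nat.pow_le_pow_right (by omega) (by omega)
    simp only [eval_sub, eval_mul, eval_C, eval_pow, map_sub, map_mul, map_pow, hD i hi',
      hD (m - i) (by omega), hα, hpL]
    have e2 : algebraMap Fq[X] L P ^ (q ^ (m + 1) - 2) =
        algebraMap Fq[X] L P ^ (q ^ (m + 1) - 2 - (q ^ i - 1)) *
          algebraMap Fq[X] L P ^ (q ^ i - 1) := by
      rw [← pow_add]; congr 1; omega
    have e3 : algebraMap Fq[X] L P ^ (q ^ (m + 1) - 2) =
        algebraMap Fq[X] L P ^ (q ^ (i + 1) - 2) *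
          (algebraMap Fq[X] L P ^ (q ^ (m - i) - 1)) ^ (q ^ (i + 1)) := by
      rw [← pow_mul, ← pow_add, Nat.sub_mul, h2]; congr 1; omega
    rw [mul_sub]
    nth_rewrite 1 [e2]
    rw [e3, mul_pow, ← hq]
    ring

end IntegralCoeff

/-! ### The orbit map as a `P`-adic limit, and the identity principle for divisible points. -/

section AnalyticOrbit

variable {Fq : Type*} [Field Fq] [Finite Fq]
  {O : Type*} [CommRing O] [IsDomain O] [ValuationRing O] [Algebra Fq[X] O]
  {K : Type*} [Field K] [Algebra Fq[X] K] {L : Type*} [Field L] [Algebra K L]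
  [Algebra Fq[X] L] [IsScalarTower Fq[X] K L] [Algebra O L] [IsScalarTower Fq[X] O L]

/-- The orbit map `a ↦ φ_a(γ)` of a point `γ` divisible by `P ^ 2` is a `P`-adic limit of
integral polynomials in `a`. -/
lemma DrinfeldModule.exists_orbit_approximation (φ : DrinfeldModule Fq K) {P : Fq[X]}
    (hP : Irreducible P) (hPO : ¬ IsUnit (algebraMap Fq[X] O P))
    (hα : ∀ i, ∃ α : O, algebraMap O L α = algebraMap K L ((φ.toRingHom X).coeff i))
    {γ : L} (hγ : ∃ η : O, γ = algebraMap Fq[X] L P ^ 2 * algebraMap O L η) :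
    ∃ y : ℕ → O[X], (∀ k j, k ≤ j → C (algebraMap Fq[X] O P ^ k) ∣ y j - y k) ∧
      ∀ a : Fq[X], ∀ᶠ k in Filter.atTop,
        algebraMap O L ((y k).eval (algebraMap Fq[X] O a)) =
          TwistedPolynomial.toEnd L (φ.toRingHom a) γ := by
  choose α hα using hα
  obtain ⟨η, rfl⟩ := hγ
  choose D hD using φ.exists_coeff_polynomial hP hPO α hα
  set q := Nat.card Fq
  have hq2 : 2 ≤ q := two_le_card Fq
  set p : O := algebraMap Fq[X] O P with hp
  have hpL : algebraMap O L p = algebraMap Fq[X] L P :=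
    (IsScalarTower.algebraMap_apply Fq[X] O L P).symm
  -- Of the factor P^(2q^n) in γ^(q^n), q^n - 1 powers clear the denominator and q^n + 1 remain,
  -- which forces convergence. Divisibility by `P` alone would leave a single factor.
  refine ⟨fun k ↦ ∑ n ∈ Finset.range k, C (p ^ (q ^ n + 1) * η ^ (q ^ n)) * D n, ?_, fun a ↦ ?_⟩
  · intro k j hkj
    rw [← Finset.sum_Ico_eq_sub _ hkj]
    refine Finset.dvd_sum fun n hn ↦ ?_
    have hn' := (Finset.mem_Ico.mp hn).1
    have := Nat.lt_pow_self hq2 (n := n)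
    exact ((C_dvd_iff_dvd_coeff _ _).mpr fun i ↦ by
      rw [coeff_C_mul, mul_assoc]
      exact (pow_dvd_pow p (by omega)).mul_right _)
  · obtain ⟨N, hN⟩ := TwistedPolynomial.exists_forall_toEnd_eq_sum L (φ.toRingHom a)
    filter_upwards [Filter.eventually_ge_atTop N] with k hk
    rw [hN k hk, eval_finsetSum, map_sum]
    refine Finset.sum_congr rfl fun n _ ↦ ?_
    have h1 : 1 ≤ q ^ n := Nat.one_le_pow _ _ (by omega)
    rw [eval_mul, eval_C, map_mul, map_mul, map_pow, map_pow, hpL, hD, mul_pow, ← pow_mul]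
    have e : algebraMap Fq[X] L P ^ (2 * q ^ n) =
        algebraMap Fq[X] L P ^ (q ^ n + 1) * algebraMap Fq[X] L P ^ (q ^ n - 1) := by
      rw [← pow_add]; congr 1; omega
    rw [e]
    ring

/-- The substitution `X ↦ δ + X`. -/
def translatePoly {σ R : Type*} [CommRing R] (δ : σ → R) : MvPolynomial σ R →ₐ[R] MvPolynomial σ R :=
  MvPolynomial.aeval fun i ↦ MvPolynomial.C (δ i) + MvPolynomial.X i

lemma aeval_translatePoly {σ R S : Type*} [CommRing R] [CommRing S] [Algebra R S] (δ : σ → R)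
    (x : σ → S) (f : MvPolynomial σ R) :
    MvPolynomial.aeval x (translatePoly δ f) =
      MvPolynomial.aeval (fun i ↦ algebraMap R S (δ i) + x i) f := by
  rw [translatePoly, ← AlgHom.comp_apply, MvPolynomial.comp_aeval]
  simp

variable [IsFractionRing O L]

omit [IsDomain O] [ValuationRing O] in
lemma exists_integer_multiple_mvPolynomial {σ : Type*} (f : MvPolynomial σ L) :
    ∃ (c : O) (G : MvPolynomial σ O), c ∈ nonZeroDivisors O ∧
      MvPolynomial.map (algebraMap O L) G = MvPolynomial.C (algebraMap O L c) * f := by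
  classical
  obtain ⟨c, hc⟩ := IsLocalization.exist_integer_multiples_of_finset (nonZeroDivisors O)
    (f.support.image fun m ↦ f.coeff m)
  have hr : MvPolynomial.C (algebraMap O L c) * f ∈ (MvPolynomial.map (σ := σ)
      (algebraMap O L)).range := by
    refine MvPolynomial.mem_range_map_iff_coeffs_subset.mpr ?_
    intro x hx
    obtain ⟨m, hm, rfl⟩ := MvPolynomial.mem_coeffs_iff.mp hx
    rw [MvPolynomial.coeff_C_mul]
    by_cases hm' : m ∈ f.support
    · obtain ⟨z, hz⟩ := hc _ (Finset.mem_image_of_mem _ hm')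
      exact ⟨z, by rw [hz, Algebra.smul_def]⟩
    · rw [MvPolynomial.notMem_support_iff.mp hm', mul_zero]
      exact ⟨0, map_zero _⟩
  obtain ⟨G, hG⟩ := hr
  exact ⟨c, G, c.2, hG⟩

variable {g : ℕ} (φ : Fin g → DrinfeldModule Fq K)

/-- A polynomial which vanishes at infinitely many points `δ + a • γ` of the translate of a
cyclic `φ`-submodule by `δ`, where `γ` is divisible by `P ^ 2`, vanishes at all of them. -/
theorem eval_orbit_eq_zero_of_infinite {P : Fq[X]}
    (hP : Irreducible P) (hPO : ¬ IsUnit (algebraMap Fq[X] O P))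
    (hinj : Function.Injective (algebraMap Fq[X] O))
    (hsep : ∀ x : O, (∀ n, algebraMap Fq[X] O P ^ n ∣ x) → x = 0)
    (hα : ∀ i n, ∃ α : O, algebraMap O L α = algebraMap K L (((φ i).toRingHom X).coeff n))
    (δ γ : Points φ L) (hγ : ∀ i, ∃ η : O, γ i = algebraMap Fq[X] L P ^ 2 * algebraMap O L η)
    (f : MvPolynomial (Fin g) L)
    (hf : {a : Fq[X] | MvPolynomial.eval (δ + a • γ : Points φ L) f = 0}.Infinite) (a : Fq[X]) :
    MvPolynomial.eval (δ + a • γ : Points φ L) f = 0 := by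
  choose y hy hya using fun i ↦
    (φ i).exists_orbit_approximation (L := L) hP hPO (hα i) (hγ i)
  -- Neither δ nor the coefficients of `f` need be integral; δ is absorbed into `f` first, then all
  -- denominators are cleared at once.
  obtain ⟨c, G, hc, hG⟩ := exists_integer_multiple_mvPolynomial (O := O)
    (translatePoly (δ : Fin g → L) f)
  have hcL : algebraMap O L c ≠ 0 := by
    rw [Ne, IsFractionRing.to_map_eq_zero_iff]
    exact nonZeroDivisors.ne_zero hc
  have hO : Function.Injective (algebraMap O L) := IsFractionRing.injective O L
  let F : ℕ → O[X] := fun k ↦ MvPolynomial.aeval (fun i ↦ y i k) G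
  have hFeval : ∀ (k : ℕ) (z : O), (F k).eval z = MvPolynomial.eval (fun i ↦ (y i k).eval z) G := by
    intro k z
    change Polynomial.evalRingHom z (MvPolynomial.aeval (fun i ↦ y i k) G) = _
    rw [MvPolynomial.aeval_def, MvPolynomial.hom_eval₂, MvPolynomial.eval, MvPolynomial.coe_eval₂Hom]
    congr 1
    ext x
    simp
  have hlim : ∀ b : Fq[X], ∀ᶠ k in Filter.atTop,
      algebraMap O L ((F k).eval (algebraMap Fq[X] O b)) =
        algebraMap O L c * MvPolynomial.eval (δ + b • γ : Points φ L) f := by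
    intro b
    filter_upwards [Filter.eventually_all.mpr fun i ↦ hya i b] with k hk
    have e : MvPolynomial.eval (fun i ↦ algebraMap O L ((y i k).eval (algebraMap Fq[X] O b)))
        (MvPolynomial.map (algebraMap O L) G) =
        algebraMap O L (MvPolynomial.eval (fun i ↦ (y i k).eval (algebraMap Fq[X] O b)) G) :=
      (MvPolynomial.map_eval _ _ _).symm
    rw [hFeval, ← e, hG, map_mul, MvPolynomial.eval_C]
    congr 1
    refine (aeval_translatePoly (δ : Fin g → L) _ f).trans ?_
    rw [MvPolynomial.aeval_eq_eval]
    congr 2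
    funext i
    rw [hk]
    rfl
  have hF : ∀ k j, k ≤ j → C (algebraMap Fq[X] O P ^ k) ∣ F j - F k := by
    intro k j hkj
    rw [← Ideal.mem_span_singleton, ← Ideal.Quotient.eq]
    have h1 : ∀ l, Ideal.Quotient.mk (Ideal.span {C (algebraMap Fq[X] O P ^ k)}) (F l) =
        MvPolynomial.aeval (fun i ↦ Ideal.Quotient.mk
          (Ideal.span {C (algebraMap Fq[X] O P ^ k)}) (y i l)) G := by
      intro l
      exact MvPolynomial.hom_eval₂ _ _ _ _
    rw [h1, h1]
    congr 2
    funext i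
    rw [Ideal.Quotient.eq, Ideal.mem_span_singleton]
    exact hy i k j hkj
  obtain ⟨k, hk⟩ := (hlim a).exists
  have hca : ∀ᶠ k' in Filter.atTop,
      (F k').eval (algebraMap Fq[X] O a) = (F k).eval (algebraMap Fq[X] O a) := by
    filter_upwards [hlim a] with k' hk'
    exact hO (hk'.trans hk.symm)
  have h0 := eventually_eval_eq_zero_of_infinite hsep F hF (hf.image hinj.injOn) (by
    rintro _ ⟨b, hb, rfl⟩
    filter_upwards [hlim b] with k' hk'
    refine hO ?_
    rw [hk', map_zero]
    exact mul_eq_zero_of_right _ hb) hca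
  rw [h0, map_zero] at hk
  exact (mul_eq_zero.mp hk.symm).resolve_left hcL

end AnalyticOrbit

/-! ### Finiteness and rank of modules over `F[X]`. -/

section FiniteModules

variable {F : Type*} [Field F] [Finite F]

lemma finite_quotient_span_singleton {c : F[X]} (hc : c ≠ 0) :
    Finite (F[X] ⧸ Ideal.span {c}) := by
  have : Module.Finite F (AdjoinRoot c) := (AdjoinRoot.powerBasis hc).finite
  exact (Module.finite_of_finite F : Finite (AdjoinRoot c))

lemma finite_of_forall_smul_eq_zero {M : Type*} [AddCommGroup M] [Module F[X] M]
    [Module.Finite F[X] M] {c : F[X]} (hc : c ≠ 0) (h : ∀ x : M, c • x = 0) : Finite M := by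
  have := finite_quotient_span_singleton hc
  have ht : Module.IsTorsionBySet F[X] M (Ideal.span {c} : Ideal F[X]) :=
    (Module.isTorsionBySet_span_singleton_iff c).mpr h
  let _ := ht.module
  have : IsScalarTower F[X] (F[X] ⧸ Ideal.span {c}) M := ht.isScalarTower
  have : Module.Finite (F[X] ⧸ Ideal.span {c}) M := Module.Finite.of_restrictScalars_finite F[X] _ _
  exact Module.finite_of_finite (F[X] ⧸ Ideal.span {c})

/-- Rank is additive and the span already has nonzero rank, so the quotient is torsion; being
finitely generated, it is killed by one nonzero polynomial. -/
lemma finite_quotient_span_singleton_of_rank_eq_one {M : Type*} [AddCommGroup M] [Module F[X] M]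
    [Module.Finite F[X] M] (hM : Module.rank F[X] M = 1) {γ : M} (hγ : ∀ a : F[X], a • γ = 0 → a = 0) :
    Finite (M ⧸ Submodule.span F[X] {γ}) := by
  have h1 : Module.rank F[X] (Submodule.span F[X] {γ}) ≠ 0 := by
    rw [Ne, rank_eq_zero_iff]
    intro h
    obtain ⟨a, ha, h⟩ := h ⟨γ, Submodule.mem_span_singleton_self γ⟩
    exact ha (hγ a (congrArg Subtype.val h))
  have h0 : Module.rank F[X] (M ⧸ Submodule.span F[X] {γ}) = 0 := by
    by_contra h0
    have := add_le_add (Cardinal.one_le_iff_ne_zero.mpr h0) (Cardinal.one_le_iff_ne_zero.mpr h1)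
    rw [rank_quotient_add_rank_of_isDomain, hM, one_add_one_eq_two] at this
    exact absurd this (by norm_num)
  have ht : Module.IsTorsion F[X] (M ⧸ Submodule.span F[X] {γ}) := by
    intro x
    obtain ⟨a, ha, h⟩ := rank_eq_zero_iff.mp h0 x
    exact ⟨⟨a, mem_nonZeroDivisors_of_ne_zero ha⟩, h⟩
  obtain ⟨c, hc, hc0⟩ := Submodule.annihilator_top_inter_nonZeroDivisors ht
  exact finite_of_forall_smul_eq_zero (nonZeroDivisors.ne_zero hc0) fun x ↦
    Submodule.mem_annihilator.mp hc x trivial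

omit [Finite F] in
-- Tensoring with Fq(t) is localization at the nonzero polynomials, which preserves rank.
lemma rank_eq_one_of_phiRank_eq_one {M : Type*} [AddCommGroup M] [Module F[X] M]
    (h : phiRank F M = 1) : Module.rank F[X] M = 1 := by
  have h1 := IsLocalizedModule.lift_rank_eq (nonZeroDivisors F[X])
    (TensorProduct.mk F[X] (RatFunc F) M 1) le_rfl
  rw [← IsLocalization.rank_eq (RatFunc F) (nonZeroDivisors F[X]) le_rfl] at h1
  rw [phiRank] at h
  rw [h, Cardinal.lift_one] at h1
  exact Cardinal.lift_eq_one.mp h1.symm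

end FiniteModules

/-! ### Subrings stable under a Drinfeld module. -/

section Stable

variable {Fq : Type*} [Field Fq] [Finite Fq] {K : Type*} [Field K] [Algebra Fq[X] K]
  {L : Type*} [Field L] [Algebra K L]

lemma TwistedPolynomial.toEnd_mem (T : Subring L) (f : TwistedPolynomial Fq K)
    (hf : ∀ n, algebraMap K L (f.coeff n) ∈ T) {x : L} (hx : x ∈ T) :
    TwistedPolynomial.toEnd L f x ∈ T := by
  obtain ⟨N, hN⟩ := f.exists_forall_toEnd_eq_sum L
  rw [hN N le_rfl]
  exact sum_mem fun n _ ↦ mul_mem (hf n) (pow_mem hx _)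

omit [Field Fq] [Finite Fq] [Algebra Fq[X] K] in
lemma TwistedPolynomial.finite_range_coeff (f : TwistedPolynomial Fq K) :
    (Set.range f.coeff).Finite := by
  refine ((Set.finite_singleton (0 : K)).union
    ((SkewPolynomial.support (R := K) f).finite_toSet.image f.coeff)).subset ?_
  rintro _ ⟨n, rfl⟩
  by_cases h : n ∈ SkewPolynomial.support (R := K) f
  · exact Or.inr ⟨n, h, rfl⟩
  · exact Or.inl (SkewPolynomial.notMem_support_iff (R := K) |>.mp h)

/-- The coefficients of `φ_t` and of `φ_c`, for `c` a constant. -/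
def DrinfeldModule.generatingCoeffs (φ : DrinfeldModule Fq K) : Set K :=
  Set.range (φ.toRingHom X).coeff ∪ ⋃ c : Fq, Set.range (φ.toRingHom (C c)).coeff

lemma DrinfeldModule.finite_generatingCoeffs (φ : DrinfeldModule Fq K) :
    φ.generatingCoeffs.Finite :=
  (TwistedPolynomial.finite_range_coeff _).union
    (Set.finite_iUnion fun _ ↦ TwistedPolynomial.finite_range_coeff _)

/-- It suffices to treat t and the constants, which generate `Fq[X]`. Constants need their own
coefficients because the definition does not impose φ_c = cτ^0. -/
lemma DrinfeldModule.toEnd_mem (φ : DrinfeldModule Fq K) (T : Subring L)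
    (hT : ∀ c ∈ φ.generatingCoeffs, algebraMap K L c ∈ T) (a : Fq[X]) :
    ∀ x ∈ T, TwistedPolynomial.toEnd L (φ.toRingHom a) x ∈ T := by
  have hC : ∀ c : Fq, ∀ x ∈ T, TwistedPolynomial.toEnd L (φ.toRingHom (C c)) x ∈ T := fun c x hx ↦
    TwistedPolynomial.toEnd_mem T _ (fun n ↦ hT _ (Or.inr (Set.mem_iUnion.mpr ⟨c, n, rfl⟩))) hx
  have hX : ∀ x ∈ T, TwistedPolynomial.toEnd L (φ.toRingHom X) x ∈ T := fun x hx ↦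
    TwistedPolynomial.toEnd_mem T _ (fun n ↦ hT _ (Or.inl ⟨n, rfl⟩)) hx
  induction a using Polynomial.induction_on with
  | C c => exact hC c
  | add a b ha hb =>
    intro x hx
    rw [map_add, map_add]
    exact add_mem (ha x hx) (hb x hx)
  | monomial n c h =>
    intro x hx
    rw [pow_succ, ← mul_assoc, map_mul, map_mul]
    exact h _ (hX x hx)

end Stable

/-! ### A place of `L` above a prime `P` of `A`. -/

section Place

variable {Fq : Type*} [Field Fq] [Finite Fq] {L : Type*} [Field L] [Algebra Fq[X] L]

omit [Finite Fq] in
lemma exists_valuationSubring_dominating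
    (hinj : Function.Injective (algebraMap Fq[X] L)) {P : Fq[X]} (hP : Irreducible P) :
    ∃ O : ValuationSubring L, (∀ a, algebraMap Fq[X] L a ∈ O) ∧ algebraMap Fq[X] L P ∈ O.nonunits := by
  let A := (algebraMap Fq[X] L).range
  let p : A := ⟨algebraMap Fq[X] L P, P, rfl⟩
  have hI : Ideal.span {p} ≠ ⊤ := by
    rw [Ne, Ideal.span_singleton_eq_top, isUnit_iff_exists_inv]
    rintro ⟨⟨_, b, rfl⟩, hb⟩
    refine hP.not_isUnit (isUnit_iff_exists_inv.mpr ⟨b, hinj ?_⟩)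
    rw [map_mul, map_one]
    exact congrArg Subtype.val hb
  obtain ⟨O, hO, h⟩ := Ideal.image_subset_nonunits_valuationSubring _ hI
  exact ⟨O, fun a ↦ hO ⟨a, rfl⟩, h ⟨p, Ideal.mem_span_singleton_self p, rfl⟩⟩

omit [Finite Fq] in
-- Euclid's argument: take an irreducible factor of t·d + 1.
lemma exists_irreducible_not_dvd {d : Fq[X]} (hd : d ≠ 0) : ∃ P : Fq[X], Irreducible P ∧ ¬ P ∣ d := by
  have h : (X * d + 1).natDegree ≠ 0 := by
    rw [← C_1, natDegree_add_C, natDegree_X_mul hd]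
    omega
  obtain ⟨P, hP, hPd⟩ := exists_irreducible_of_natDegree_ne_zero h
  refine ⟨P, hP, fun hd ↦ hP.not_isUnit (isUnit_of_dvd_one ?_)⟩
  exact (dvd_add_right (hd.mul_left X)).mp hPd

variable {O : Type*} [CommRing O] [IsDomain O] [ValuationRing O] [Algebra Fq[X] O] [Algebra O L]
  [IsScalarTower Fq[X] O L] [IsFractionRing O L]

omit [Finite Fq] in
lemma exists_algebraMap_eq_of_isIntegral {x : L} (hx : IsIntegral Fq[X] x) :
    ∃ y : O, algebraMap O L y = x :=
  IsIntegrallyClosed.isIntegral_iff.mp (hx.tower_top (A := O))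

omit [Finite Fq] in
-- A valuation ring of a large algebraic extension need not be Noetherian, so algebraicity replaces
-- Krull's intersection theorem: some nonzero c in `A` makes c/x integral, so x divides c in `O`,
-- and c is a unit times a fixed power of `P`.
lemma eq_zero_of_forall_pow_dvd [Algebra.IsAlgebraic Fq[X] L] {P : Fq[X]} (hP : Irreducible P)
    (hPO : ¬ IsUnit (algebraMap Fq[X] O P)) (hinj : Function.Injective (algebraMap Fq[X] O))
    (x : O) (hx : ∀ n, algebraMap Fq[X] O P ^ n ∣ x) : x = 0 := by
  by_contra hx0
  have hO : Function.Injective (algebraMap O L) := IsFractionRing.injective O L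
  obtain ⟨c, hc, hci⟩ := (Algebra.IsAlgebraic.isAlgebraic (R := Fq[X])
    (algebraMap O L x)⁻¹).exists_integral_multiple
  obtain ⟨y, hy⟩ := exists_algebraMap_eq_of_isIntegral (O := O) hci
  have hcx : algebraMap Fq[X] O c = y * x := by
    apply hO
    rw [map_mul, hy, Algebra.smul_def, mul_assoc, inv_mul_cancel₀, mul_one,
      ← IsScalarTower.algebraMap_apply]
    exact (map_ne_zero_iff _ hO).mpr hx0
  obtain ⟨n, b, hb, rfl⟩ := WfDvdMonoid.max_power_factor hc hP
  obtain ⟨u, hu⟩ := isUnit_algebraMap_of_not_dvd (O := O) hP hPO hb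
  obtain ⟨z, hz⟩ := hx (n + 1)
  rw [map_mul, map_pow, ← hu, hz] at hcx
  have hp0 : algebraMap Fq[X] O P ≠ 0 := (map_ne_zero_iff _ hinj).mpr hP.ne_zero
  refine hPO (IsUnit.of_mul_eq_one (y * z * ↑u⁻¹) ?_)
  refine mul_left_cancel₀ (pow_ne_zero n hp0) ?_
  calc algebraMap Fq[X] O P ^ n * (algebraMap Fq[X] O P * (y * z * ↑u⁻¹))
      = (y * (algebraMap Fq[X] O P ^ (n + 1) * z)) * ↑u⁻¹ := by ring
    _ = _ := by rw [← hcx, mul_assoc, Units.mul_inv]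

omit [IsDomain O] [ValuationRing O] in
/-- The residues modulo `P ^ 2` of a finitely generated ring of elements which are integral away
from a denominator prime to `P` form a finite ring. -/
lemma finite_adjoin_residues {P d : Fq[X]} (hP : Irreducible P) (hPd : ¬ P ∣ d) {s : Set O}
    (hs : s.Finite) (hint : ∀ x ∈ s, IsIntegral Fq[X] (d • x)) :
    Finite (Algebra.adjoin Fq[X]
      (Ideal.Quotient.mkₐ Fq[X] (Ideal.span {algebraMap Fq[X] O P ^ 2}) '' s)) := by
  set π := Ideal.Quotient.mkₐ Fq[X] (Ideal.span {algebraMap Fq[X] O P ^ 2}) with hπ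
  have hP2 : algebraMap Fq[X] (O ⧸ Ideal.span {algebraMap Fq[X] O P ^ 2}) (P ^ 2) = 0 := by
    rw [← π.commutes, map_pow]
    exact Ideal.Quotient.eq_zero_iff_mem.mpr (Ideal.mem_span_singleton_self _)
  obtain ⟨e, v, hev⟩ : IsCoprime d (P ^ 2) :=
    ((hP.coprime_iff_not_dvd.mpr hPd).symm).pow_right
  have : Module.Finite Fq[X] (Algebra.adjoin Fq[X] (π '' s)) := by
    refine Algebra.finite_adjoin_of_finite_of_isIntegral (hs.image _) ?_
    rintro _ ⟨x, hx, rfl⟩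
    -- Modulo P^2 the relation ed + vP^2 = 1 turns e·(dx) into x, so the residue of x is itself
    -- integral.
    have h := ((hint x hx).map π).smul e
    rw [map_smul, smul_smul, eq_sub_of_add_eq hev, sub_smul, one_smul, mul_smul,
      Algebra.smul_def (P ^ 2), hP2, zero_mul, smul_zero, sub_zero] at h
    exact h
  refine finite_of_forall_smul_eq_zero (pow_ne_zero 2 hP.ne_zero) fun x ↦ Subtype.ext ?_
  change P ^ 2 • (x : O ⧸ Ideal.span {algebraMap Fq[X] O P ^ 2}) = 0
  rw [Algebra.smul_def, hP2, zero_mul]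

end Place

/-! ### The identity principle for a nonzero multiple of an arbitrary point. -/

section OrbitIdentity

variable {Fq : Type*} [Field Fq] [Finite Fq] {K : Type*} [Field K] [Algebra Fq[X] K]
  {L : Type*} [Field L] [Algebra K L] [Algebra Fq[X] L] [IsScalarTower Fq[X] K L]

omit [IsScalarTower Fq[X] K L] in
/-- Some nonzero multiple of an integral point is divisible by `P ^ 2`. -/
lemma exists_smul_dvd_sq {O : Type*} [CommRing O] [Algebra Fq[X] O] [Algebra O L]
    [IsScalarTower Fq[X] O L] {g : ℕ} (φ : Fin g → DrinfeldModule Fq K)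
    {P d : Fq[X]} (hP : Irreducible P) (hPd : ¬ P ∣ d) {s : Set O}
    (hs : s.Finite) (hint : ∀ x ∈ s, IsIntegral Fq[X] (d • x))
    (hcoeff : ∀ i, ∀ c ∈ (φ i).generatingCoeffs, ∃ x ∈ s, algebraMap O L x = algebraMap K L c)
    (γ : Points φ L) (hγ : ∀ i, ∃ x ∈ s, algebraMap O L x = γ i) :
    ∃ a : Fq[X], a ≠ 0 ∧ ∀ i, ∃ η : O,
      (a • γ) i = algebraMap Fq[X] L P ^ 2 * algebraMap O L η := by
  have hfin := finite_adjoin_residues hP hPd hs hint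
  set π := Ideal.Quotient.mkₐ Fq[X] (Ideal.span {algebraMap Fq[X] O P ^ 2}) with hπ
  set S := Algebra.adjoin Fq[X] (π '' s) with hS
  -- The elements of `O` with residue in the finite ring `S`: this contains the coordinates of γ and
  -- is stable under every φ_a.
  let T : Subring L := (S.toSubring.comap (π : O →+* _)).map (algebraMap O L)
  have hsT : ∀ x ∈ s, algebraMap O L x ∈ T := fun x hx ↦
    ⟨x, Algebra.subset_adjoin (Set.mem_image_of_mem _ hx), rfl⟩
  have hmem : ∀ (a : Fq[X]) i, ∃ r : O, π r ∈ S ∧ algebraMap O L r = (a • γ) i := by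
    intro a i
    refine (φ i).toEnd_mem T (fun c hc ↦ ?_) a (γ i) ?_
    · obtain ⟨x, hx, hxc⟩ := hcoeff i c hc
      exact hxc ▸ hsT x hx
    · obtain ⟨x, hx, hxc⟩ := hγ i
      exact hxc ▸ hsT x hx
  choose r hrS hr using hmem
  -- Pigeonhole: infinitely many multipliers, finitely many residue vectors. The difference of two
  -- that agree sends γ into P^2 `O`.
  obtain ⟨a, b, hab, h⟩ := Finite.exists_ne_map_eq_of_infinite
    (fun (a : Fq[X]) (i : Fin g) ↦ (⟨π (r a i), hrS a i⟩ : S))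
  refine ⟨a - b, sub_ne_zero.mpr hab, fun i ↦ ?_⟩
  have h1 : π (r a i) = π (r b i) := congrArg Subtype.val (congrFun h i)
  obtain ⟨η, hη⟩ := Ideal.mem_span_singleton.mp (Ideal.Quotient.eq.mp h1)
  refine ⟨η, ?_⟩
  rw [sub_smul]
  change (a • γ) i - (b • γ) i = _
  rw [← hr, ← hr, ← map_sub, hη, map_mul, map_pow, ← IsScalarTower.algebraMap_apply]

/-- Every point `γ` has a nonzero multiple `γ'` such that a polynomial vanishing at infinitely
many points of a coset `δ + A γ'` vanishes on the whole coset. -/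
theorem exists_smul_eval_eq_zero_of_infinite [Algebra.IsAlgebraic Fq[X] L]
    (hinj : Function.Injective (algebraMap Fq[X] L)) {g : ℕ} (φ : Fin g → DrinfeldModule Fq K)
    (γ : Points φ L) :
    ∃ a : Fq[X], a ≠ 0 ∧ ∀ (δ : Points φ L) (f : MvPolynomial (Fin g) L),
      {b : Fq[X] | MvPolynomial.eval (δ + b • a • γ : Points φ L) f = 0}.Infinite →
        ∀ b : Fq[X], MvPolynomial.eval (δ + b • a • γ : Points φ L) f = 0 := by
  let s : Set L := Set.range (γ : Fin g → L) ∪ ⋃ i, algebraMap K L '' (φ i).generatingCoeffs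
  have hs : s.Finite := (Set.finite_range _).union
    (Set.finite_iUnion fun i ↦ (φ i).finite_generatingCoeffs.image _)
  obtain ⟨d, hd, hint⟩ := Algebra.IsAlgebraic.exists_integral_multiples Fq[X] hs.toFinset
  simp only [Set.Finite.mem_toFinset] at hint
  obtain ⟨P, hP, hPd⟩ := exists_irreducible_not_dvd hd
  obtain ⟨O, hAO, hPO⟩ := exists_valuationSubring_dominating hinj hP
  let _ : Algebra Fq[X] O := ((algebraMap Fq[X] L).codRestrict O.toSubring hAO).toAlgebra
  have : IsScalarTower Fq[X] O L := IsScalarTower.of_algebraMap_eq fun _ ↦ rfl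
  have hPO' : ¬ IsUnit (algebraMap Fq[X] O P) := by
    obtain ⟨_, h⟩ := ValuationSubring.mem_nonunits_iff_exists_mem_maximalIdeal.mp hPO
    exact (IsLocalRing.mem_maximalIdeal _).mp h
  have hO : Function.Injective (algebraMap O L) := IsFractionRing.injective O L
  have hinj' : Function.Injective (algebraMap Fq[X] O) := fun x y h ↦
    hinj (congrArg (algebraMap O L) h)
  have hsO : ∀ x ∈ s, ∃ y ∈ algebraMap O L ⁻¹' s, algebraMap O L y = x := by
    intro x hx
    obtain ⟨y, hy⟩ := exists_algebraMap_eq_of_isIntegral (O := O) (hint x hx)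
    obtain ⟨u, hu⟩ := isUnit_algebraMap_of_not_dvd (O := O) hP hPO' hPd
    have : algebraMap O L (↑u⁻¹ * y) = x := by
      rw [map_mul, hy, Algebra.smul_def, IsScalarTower.algebraMap_apply Fq[X] O L, ← hu,
        ← mul_assoc, ← map_mul, Units.inv_mul, map_one, one_mul]
    exact ⟨_, by rw [Set.mem_preimage, this]; exact hx, this⟩
  have hcoeff : ∀ i, ∀ c ∈ (φ i).generatingCoeffs,
      ∃ x ∈ algebraMap O L ⁻¹' s, algebraMap O L x = algebraMap K L c := fun i c hc ↦
    hsO _ (Or.inr (Set.mem_iUnion.mpr ⟨i, c, hc, rfl⟩))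
  obtain ⟨a, ha, hη⟩ := exists_smul_dvd_sq φ hP hPd (hs.preimage hO.injOn)
    (fun x hx ↦ (isIntegral_algebraMap_iff hO).mp (by
      rw [Algebra.smul_def, map_mul, ← IsScalarTower.algebraMap_apply, ← Algebra.smul_def]
      exact hint _ hx)) hcoeff γ (fun i ↦ hsO _ (Or.inl ⟨i, rfl⟩))
  refine ⟨a, ha, fun δ f hf ↦ eval_orbit_eq_zero_of_infinite φ hP hPO' hinj'
    (eq_zero_of_forall_pow_dvd (L := L) hP hPO' hinj') (fun i n ↦ ?_) δ (a • γ) hη f hf⟩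
  obtain ⟨x, -, hx⟩ := hcoeff i _ (Or.inl ⟨n, rfl⟩)
  exact ⟨x, hx⟩

end OrbitIdentity

/-! ### Finite unions of cosets. -/

section CosetUnions

variable {R M : Type*} [Ring R] [AddCommGroup M] [Module R M] {Γ : Submodule R M}

lemma IsFiniteUnionOfCosets.of_finite_index {ι : Type*} [Finite ι] {γ : ι → M}
    {N : ι → Submodule R M} (h : ∀ i, γ i ∈ Γ ∧ N i ≤ Γ) :
    IsFiniteUnionOfCosets Γ (⋃ i, (fun y ↦ γ i + y) '' (N i : Set M)) := by
  obtain ⟨n, ⟨e⟩⟩ := Finite.exists_equiv_fin ι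
  exact ⟨n, γ ∘ e.symm, N ∘ e.symm, fun i ↦ h _,
    (e.symm.surjective.iUnion_comp fun i ↦ (fun y ↦ γ i + y) '' (N i : Set M)).symm⟩

lemma IsFiniteUnionOfCosets.iUnion {ι : Type*} [Finite ι] {S : ι → Set M}
    (h : ∀ i, IsFiniteUnionOfCosets Γ (S i)) : IsFiniteUnionOfCosets Γ (⋃ i, S i) := by
  choose n γ N hΓ hS using h
  have := IsFiniteUnionOfCosets.of_finite_index (Γ := Γ) (ι := Σ i, Fin (n i))
    (γ := fun x ↦ γ x.1 x.2) (N := fun x ↦ N x.1 x.2) fun x ↦ hΓ x.1 x.2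
  rw [Set.iUnion_sigma] at this
  simpa only [hS] using this

lemma IsFiniteUnionOfCosets.of_finite {S : Set M} (hS : S.Finite) (hΓ : S ⊆ Γ) :
    IsFiniteUnionOfCosets Γ S := by
  have := hS.to_subtype
  have := IsFiniteUnionOfCosets.of_finite_index (Γ := Γ) (ι := S) (γ := (↑)) (N := fun _ ↦ ⊥)
    fun x ↦ ⟨hΓ x.2, bot_le⟩
  simpa using this

lemma IsFiniteUnionOfCosets.of_coset {γ : M} (hγ : γ ∈ Γ) {N : Submodule R M} (hN : N ≤ Γ) :
    IsFiniteUnionOfCosets Γ ((fun y ↦ γ + y) '' (N : Set M)) := by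
  have := IsFiniteUnionOfCosets.of_finite_index (Γ := Γ) (ι := Unit) (γ := fun _ ↦ γ)
    (N := fun _ ↦ N) fun _ ↦ ⟨hγ, hN⟩
  rwa [Set.iUnion_const] at this

end CosetUnions

/-! ### Descent of Zariski closures to the ground field. -/

section Closure

/-- The Zariski closure of a set of rational points is defined over the ground field. -/
lemma aeval_eq_zero_of_rational {k L σ : Type*} [Field k] [Field L] [Algebra k L]
    {S : Set (σ → k)} {h : MvPolynomial σ L}
    (hS : ∀ s ∈ S, MvPolynomial.aeval (fun i ↦ algebraMap k L (s i)) h = 0) {x : σ → L}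
    (hx : ∀ f : MvPolynomial σ k, (∀ s ∈ S, MvPolynomial.eval s f = 0) →
      MvPolynomial.aeval x f = 0) :
    MvPolynomial.aeval x h = 0 := by
  classical
  let e := Module.Basis.ofVectorSpace k L
  -- Expand the coefficients of `h` in a `k`-basis of `L`, so that h = ∑ e_j f_j with f_j over `k`.
  -- At a rational point the values of the f_j lie in `k`, so independence makes each of them
  -- vanish.
  let f : Module.Basis.ofVectorSpaceIndex k L → MvPolynomial σ k := fun j ↦
    ∑ m ∈ h.support, MvPolynomial.monomial m (e.repr (h.coeff m) j)
  have hf : ∀ j, MvPolynomial.aeval x (f j) = 0 := by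
    intro j
    refine hx _ fun s hs ↦ ?_
    have h0 := congrArg (fun z ↦ e.repr z j) (hS s hs)
    simp only [MvPolynomial.aeval_def, MvPolynomial.eval₂_eq, ← map_pow, ← map_prod] at h0
    simp only [f, map_sum, MvPolynomial.eval_monomial, Finsupp.prod]
    rw [map_zero, Finsupp.zero_apply, map_sum, Finsupp.finsetSum_apply] at h0
    rw [← h0]
    refine Finset.sum_congr rfl fun m _ ↦ ?_
    rw [mul_comm _ (algebraMap k L _), ← Algebra.smul_def, map_smul, Finsupp.smul_apply,
      smul_eq_mul, mul_comm]
    rfl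
  let T := h.support.biUnion fun m ↦ (e.repr (h.coeff m)).support
  have hc : ∀ m ∈ h.support, h.coeff m = ∑ j ∈ T, e.repr (h.coeff m) j • e j := by
    intro m hm
    nth_rewrite 1 [← e.linearCombination_repr (h.coeff m)]
    rw [Finsupp.linearCombination_apply, Finsupp.sum]
    refine Finset.sum_subset (Finset.subset_biUnion_of_mem
      (fun m ↦ (e.repr (h.coeff m)).support) hm) fun j _ hj ↦ ?_
    rw [Finsupp.notMem_support_iff.mp hj, zero_smul]
  have key : MvPolynomial.aeval x h = ∑ j ∈ T, e j * MvPolynomial.aeval x (f j) := by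
    simp only [f, map_sum, MvPolynomial.aeval_monomial, Finset.mul_sum]
    rw [Finset.sum_comm, MvPolynomial.aeval_def]
    rw [MvPolynomial.eval₂_eq]
    refine Finset.sum_congr rfl fun m hm ↦ ?_
    nth_rewrite 1 [hc m hm]
    rw [map_sum, Finset.sum_mul]
    refine Finset.sum_congr rfl fun j _ ↦ ?_
    rw [Algebra.smul_def]
    simp only [Algebra.algebraMap_self, RingHom.id_apply, Finsupp.prod]
    ring
  rw [key]
  exact Finset.sum_eq_zero fun j _ ↦ by rw [hf, mul_zero]

end Closure

/-! ### Zariski closures of cyclic submodules and of their cosets. -/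

section OrbitClosure

variable {Fq : Type*} [Field Fq] [Finite Fq] {K : Type*} [Field K] [Algebra Fq[X] K]
  {L : Type*} [Field L] [Algebra K L] {g : ℕ} {φ : Fin g → DrinfeldModule Fq K}

/-- A polynomial vanishing at infinitely many points of a coset `δ + A γ` vanishes at all of
them. -/
def HasOrbitIdentity (γ : Points φ L) : Prop :=
  ∀ (δ : Points φ L) (f : MvPolynomial (Fin g) L),
    {b : Fq[X] | MvPolynomial.eval (δ + b • γ : Points φ L) f = 0}.Infinite →
      ∀ b : Fq[X], MvPolynomial.eval (δ + b • γ : Points φ L) f = 0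

lemma HasOrbitIdentity.aeval_eq_zero {γ : Points φ L} (h : HasOrbitIdentity γ)
    {k : Type*} [Field k] [Algebra k L] (δ : Points φ L) (f : MvPolynomial (Fin g) k)
    (hf : {b : Fq[X] | MvPolynomial.aeval (δ + b • γ : Points φ L) f = 0}.Infinite) (b : Fq[X]) :
    MvPolynomial.aeval (δ + b • γ : Points φ L) f = 0 := by
  have e : ∀ x : Fin g → L, MvPolynomial.aeval x f =
      MvPolynomial.eval x (MvPolynomial.map (algebraMap k L) f) := fun x ↦
    (MvPolynomial.eval_map _ _ _).symm
  refine (e _).trans (h δ _ (hf.mono fun b hb ↦ ?_) b)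
  exact (e _).symm.trans hb

/-- The coset `δ + A γ`. -/
def orbitCoset (δ γ : Points φ L) : Set (Fin g → L) :=
  Set.range fun b : Fq[X] ↦ (δ + b • γ : Points φ L)

/-- If a product vanishes on the coset, one factor vanishes for infinitely many of the infinitely
many b, hence everywhere on it. -/
lemma HasOrbitIdentity.isPrime_vanishingIdeal {γ : Points φ L} (h : HasOrbitIdentity γ)
    (k : Type*) [Field k] [Algebra k L] (δ : Points φ L) :
    (MvPolynomial.vanishingIdeal k (orbitCoset δ γ)).IsPrime := by
  refine ⟨fun h1 ↦ ?_, fun {f f'} hff ↦ ?_⟩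
  · have h2 := (MvPolynomial.mem_vanishingIdeal_iff.mp ((Ideal.eq_top_iff_one _).mp h1)) _
      ⟨(0 : Fq[X]), rfl⟩
    rw [map_one] at h2
    exact one_ne_zero h2
  · have hu : {b : Fq[X] | MvPolynomial.aeval (δ + b • γ : Points φ L) f = 0} ∪
        {b : Fq[X] | MvPolynomial.aeval (δ + b • γ : Points φ L) f' = 0} = Set.univ := by
      refine Set.eq_univ_of_forall fun b ↦ ?_
      have := MvPolynomial.mem_vanishingIdeal_iff.mp hff _ ⟨b, rfl⟩
      rw [map_mul] at this
      exact mul_eq_zero.mp this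
    rcases Set.infinite_union.mp (hu ▸ Set.infinite_univ) with hf | hf
    · refine Or.inl (MvPolynomial.mem_vanishingIdeal_iff.mpr ?_)
      rintro _ ⟨b, rfl⟩
      exact h.aeval_eq_zero δ f hf b
    · refine Or.inr (MvPolynomial.mem_vanishingIdeal_iff.mpr ?_)
      rintro _ ⟨b, rfl⟩
      exact h.aeval_eq_zero δ f' hf b

omit [Algebra K L] in
lemma aeval_translatePoly_points (δ x : Points φ L) (f : MvPolynomial (Fin g) L) :
    MvPolynomial.aeval (x : Fin g → L) (translatePoly (δ : Fin g → L) f) =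
      MvPolynomial.aeval (δ + x : Points φ L) f :=
  aeval_translatePoly (δ : Fin g → L) (x : Fin g → L) f

/-- The action of `a` is a polynomial map, hence Zariski continuous; this makes the closure of an
orbit stable under `A`. -/
lemma exists_aeval_eq_aeval_smul (φ : Fin g → DrinfeldModule Fq K) (a : Fq[X])
    (f : MvPolynomial (Fin g) L) : ∃ f' : MvPolynomial (Fin g) L, ∀ x : Points φ L,
      MvPolynomial.aeval (x : Fin g → L) f' = MvPolynomial.aeval (a • x : Points φ L) f := by
  choose N hN using fun i ↦
    TwistedPolynomial.exists_forall_toEnd_eq_sum L ((φ i).toRingHom a)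
  refine ⟨MvPolynomial.aeval (fun i ↦ ∑ n ∈ Finset.range (N i),
    MvPolynomial.C (algebraMap K L (((φ i).toRingHom a).coeff n)) *
      MvPolynomial.X i ^ (Nat.card Fq ^ n)) f, fun x ↦ ?_⟩
  rw [← AlgHom.comp_apply, MvPolynomial.comp_aeval]
  refine congrArg (fun y : Fin g → L ↦ MvPolynomial.aeval y f) (funext fun i ↦ ?_)
  rw [map_sum]
  refine Eq.trans ?_ (hN i _ le_rfl (x i)).symm
  refine Finset.sum_congr rfl fun n _ ↦ ?_
  have hX : MvPolynomial.aeval (x : Fin g → L) (MvPolynomial.X i : MvPolynomial (Fin g) L) = x i :=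
    MvPolynomial.aeval_X _ i
  rw [map_mul, map_pow, hX, MvPolynomial.algHom_C]
  rfl

/-- The Zariski closure of the cyclic `φ`-submodule generated by `γ`. -/
def orbitClosure (γ : Points φ L) : Submodule Fq[X] (Points φ L) where
  carrier := MvPolynomial.zeroLocus L (MvPolynomial.vanishingIdeal L (orbitCoset 0 γ))
  zero_mem' := MvPolynomial.zeroLocus_vanishingIdeal_le _
    ⟨(0 : Fq[X]), by simp only [zero_smul, add_zero]; rfl⟩
  add_mem' := by
    -- Closure under addition takes two rounds: translation by an orbit point preserves the closure,
    -- so translation by a point of the closure sends the orbit into the closure, and hence the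
    -- closure into itself.
    have h1 : ∀ (b : Fq[X]) (x : Points φ L),
        (∀ f ∈ MvPolynomial.vanishingIdeal L (orbitCoset 0 γ),
          MvPolynomial.aeval (x : Fin g → L) f = 0) →
        ∀ f ∈ MvPolynomial.vanishingIdeal L (orbitCoset 0 γ),
          MvPolynomial.aeval (b • γ + x : Points φ L) f = 0 := by
      intro b x hx f hf
      rw [← aeval_translatePoly_points]
      refine hx _ (MvPolynomial.mem_vanishingIdeal_iff.mpr ?_)
      rintro _ ⟨c, rfl⟩
      refine (aeval_translatePoly_points _ _ f).trans
        (MvPolynomial.mem_vanishingIdeal_iff.mp hf _ ⟨b + c, ?_⟩)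
      simp only [add_smul, zero_add]
      rfl
    intro x y hx hy f hf
    have h2 := aeval_translatePoly_points y x f
    rw [add_comm y x] at h2
    refine h2.symm.trans (hx _ (MvPolynomial.mem_vanishingIdeal_iff.mpr ?_))
    rintro _ ⟨b, rfl⟩
    refine (aeval_translatePoly_points _ _ f).trans (Eq.trans ?_ (h1 b y hy f hf))
    simp only [zero_add, add_comm y]
  smul_mem' := by
    intro a x hx f hf
    obtain ⟨f', hf'⟩ := exists_aeval_eq_aeval_smul φ a f
    refine (hf' x).symm.trans (hx _ (MvPolynomial.mem_vanishingIdeal_iff.mpr ?_))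
    rintro _ ⟨b, rfl⟩
    refine (hf' _).trans (MvPolynomial.mem_vanishingIdeal_iff.mp hf _ ⟨a * b, ?_⟩)
    simp only [zero_add, mul_smul]
    rfl

lemma HasOrbitIdentity.isAlgebraicSubmodule_orbitClosure {γ : Points φ L}
    (h : HasOrbitIdentity γ) : IsAlgebraicSubmodule φ (orbitClosure γ) := by
  refine ⟨⟨_, rfl⟩, ?_⟩
  have e := (MvPolynomial.zeroLocus_vanishingIdeal_galoisConnection
    (k := L) (K := L) (σ := Fin g)).u_l_u_eq_u (orbitCoset 0 γ)
  have := h.isPrime_vanishingIdeal L 0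
  rw [← show _ = MvPolynomial.vanishingIdeal L (orbitCoset 0 γ) from e] at this
  exact this

end OrbitClosure

/-! ### Curves over `K` containing a coset of rational points. -/

section RationalOrbit

variable {Fq : Type*} [Field Fq] [Finite Fq] {K : Type*} [Field K] [Algebra Fq[X] K]
  {L : Type*} [Field L] [Algebra K L] {g : ℕ} (φ : Fin g → DrinfeldModule Fq K)

lemma TwistedPolynomial.toEnd_algebraMap (f : TwistedPolynomial Fq K) (x : K) :
    TwistedPolynomial.toEnd L f (algebraMap K L x) =
      algebraMap K L (TwistedPolynomial.toEnd K f x) := by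
  obtain ⟨N, hN⟩ := f.exists_forall_toEnd_eq_sum L
  obtain ⟨N', hN'⟩ := f.exists_forall_toEnd_eq_sum K
  rw [hN _ (le_max_left N N'), hN' _ (le_max_right N N'), map_sum]
  simp

variable (L) in
/-- The inclusion of `Kᵍ` into `Lᵍ`. -/
def Points.baseChange : Points φ K →ₗ[Fq[X]] Points φ L where
  toFun x i := algebraMap K L (x i)
  map_add' _ _ := funext fun _ ↦ map_add (algebraMap K L) _ _
  map_smul' _ x := funext fun i ↦ (TwistedPolynomial.toEnd_algebraMap _ (x i)).symm

variable {φ}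

lemma exists_mem_orbitCoset_iff {δ γ : Points φ K} {x : Fin g → L} :
    x ∈ orbitCoset (Points.baseChange L φ δ) (Points.baseChange L φ γ) ↔
      ∃ b : Fq[X], (Points.baseChange L φ (δ + b • γ) : Fin g → L) = x := by
  simp only [map_add, map_smul]
  rfl

/-- A maximal ideal would coincide with the vanishing ideal of every point of the coset, but some
X_i - δ_i separates δ from δ + γ. -/
lemma not_isMaximal_vanishingIdeal_orbitCoset {γ : Points φ K} (hγ : γ ≠ 0) (δ : Points φ K) :
    ¬ (MvPolynomial.vanishingIdeal K (orbitCoset (Points.baseChange L φ δ)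
      (Points.baseChange L φ γ))).IsMaximal := by
  intro hJ
  have hprime : ∀ x : Fin g → L, (MvPolynomial.vanishingIdeal K {x}).IsPrime := fun _ ↦
    inferInstance
  have h : ∀ b : Fq[X], MvPolynomial.vanishingIdeal K (orbitCoset (Points.baseChange L φ δ)
      (Points.baseChange L φ γ)) =
      MvPolynomial.vanishingIdeal K {(Points.baseChange L φ (δ + b • γ) : Fin g → L)} := by
    intro b
    refine hJ.eq_of_le (hprime _).ne_top
      (MvPolynomial.vanishingIdeal_anti_mono ?_)
    rintro _ rfl
    exact exists_mem_orbitCoset_iff.mpr ⟨b, rfl⟩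
  refine hγ (funext fun i ↦ ?_)
  let f : MvPolynomial (Fin g) K := MvPolynomial.X i - MvPolynomial.C (δ i)
  have hval : ∀ x : Points φ K, MvPolynomial.aeval (Points.baseChange L φ x : Fin g → L) f =
      algebraMap K L (x i - δ i) := by
    intro x
    have hX : MvPolynomial.aeval (Points.baseChange L φ x : Fin g → L)
        (MvPolynomial.X i : MvPolynomial (Fin g) K) = algebraMap K L (x i) :=
      MvPolynomial.aeval_X _ i
    rw [map_sub, map_sub, hX, MvPolynomial.algHom_C]
  have hf : f ∈ MvPolynomial.vanishingIdeal K
      {(Points.baseChange L φ (δ + (0 : Fq[X]) • γ) : Fin g → L)} := by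
    rw [zero_smul, add_zero]
    refine (MvPolynomial.mem_vanishingIdeal_singleton_iff _ _).mpr ((hval δ).trans ?_)
    rw [sub_self, map_zero]
  rw [← h 0, h 1, one_smul] at hf
  have h1 := (hval (δ + γ)).symm.trans ((MvPolynomial.mem_vanishingIdeal_singleton_iff _ _).mp hf)
  have h2 := (map_eq_zero (algebraMap K L)).mp h1
  exact (add_sub_cancel_left (δ i) (γ i)).symm.trans h2

/-- In a domain of dimension one, nonzero primes are maximal. This identifies the ideal of the curve
with that of the coset inside it. -/
lemma eq_of_le_of_ringKrullDim_quotient_eq_one {R : Type*} [CommRing R] {p J : Ideal R}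
    [hp : p.IsPrime] [hJ : J.IsPrime] (hdim : ringKrullDim (R ⧸ p) = 1) (hle : p ≤ J)
    (hmax : ¬ J.IsMaximal) : p = J := by
  by_contra hne
  have hker : RingHom.ker (Ideal.Quotient.mk p) ≤ J := by rwa [Ideal.mk_ker]
  have hs : Function.Surjective (Ideal.Quotient.mk p) := Ideal.Quotient.mk_surjective
  have hprime : (J.map (Ideal.Quotient.mk p)).IsPrime := Ideal.map_isPrime_of_surjective hs hker
  have hne0 : J.map (Ideal.Quotient.mk p) ≠ ⊥ := by
    intro h
    rw [Ideal.map_eq_bot_iff_le_ker, Ideal.mk_ker] at h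
    exact hne (le_antisymm hle h)
  have : Ring.KrullDimLE 1 (R ⧸ p) := (Ring.krullDimLE_iff).mpr hdim.le
  have hm : (J.map (Ideal.Quotient.mk p)).IsMaximal :=
    hprime.isMaximal_of_ne_bot hne0
  refine hmax ?_
  have := Ideal.comap_isMaximal_of_surjective (Ideal.Quotient.mk p) hs
    (K := J.map (Ideal.Quotient.mk p))
  rwa [Ideal.comap_map_of_surjective _ hs, ← RingHom.ker_eq_comap_bot, Ideal.mk_ker,
    sup_eq_left.mpr hle] at this

/-- An irreducible curve over `K` which contains an infinite coset of a cyclic `φ`-submodule is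
a translate of an algebraic `φ`-submodule. -/
theorem isTranslate_of_orbit_subset {V : Set (Fin g → L)} (hV : IsIrreducibleCurve K V)
    {γ : Points φ K} (hγ : γ ≠ 0) (hid : HasOrbitIdentity (Points.baseChange L φ γ))
    {δ : Points φ K} (hδ : ∀ b : Fq[X], δ + b • γ ∈ rationalPoints φ V) :
    IsTranslateOfAlgebraicSubmodule φ V := by
  obtain ⟨⟨⟨I, hI⟩, hprime⟩, hdim⟩ := hV
  set ι := Points.baseChange L φ
  have hJ := hid.isPrime_vanishingIdeal K (ι δ)
  have hpJ : MvPolynomial.vanishingIdeal K V =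
      MvPolynomial.vanishingIdeal K (orbitCoset (ι δ) (ι γ)) := by
    refine eq_of_le_of_ringKrullDim_quotient_eq_one hdim
      (MvPolynomial.vanishingIdeal_anti_mono fun x hx ↦ ?_)
      (not_isMaximal_vanishingIdeal_orbitCoset hγ δ)
    obtain ⟨b, rfl⟩ := exists_mem_orbitCoset_iff.mp hx
    exact hδ b
  have hVJ : V = MvPolynomial.zeroLocus L
      (MvPolynomial.vanishingIdeal K (orbitCoset (ι δ) (ι γ))) := by
    rw [← hpJ, hI]
    exact ((MvPolynomial.zeroLocus_vanishingIdeal_galoisConnection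
      (k := K) (K := L) (σ := Fin g)).l_u_l_eq_l I).symm
  refine ⟨orbitClosure (ι γ), ι δ, hid.isAlgebraicSubmodule_orbitClosure, ?_⟩
  refine Set.Subset.antisymm (fun x hx ↦ ?_) ?_
  · rw [hVJ] at hx
    let x' : Points φ L := x
    refine ⟨x' - ι δ, fun f hf ↦ ?_, add_sub_cancel (ι δ) x'⟩
    -- `V` is the closure of the coset for equations over `K`, whereas `orbitClosure` uses equations
    -- over `L`; the two agree because the coset consists of `K`-points.
    have h := aeval_eq_zero_of_rational (k := K)
      (S := Set.range fun b : Fq[X] ↦ ((δ + b • γ : Points φ K) : Fin g → K))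
      (h := translatePoly (-ι δ : Points φ L) f) (x := x) ?_ ?_
    · rw [sub_eq_neg_add]
      exact (aeval_translatePoly_points (-ι δ) x' f).symm.trans h
    · rintro _ ⟨b, rfl⟩
      refine (aeval_translatePoly_points (-ι δ) (ι (δ + b • γ)) f).trans ?_
      refine MvPolynomial.mem_vanishingIdeal_iff.mp hf _ ⟨b, ?_⟩
      simp only [map_add, map_smul, neg_add_cancel_left, zero_add]
      rfl
    · intro f' hf'
      refine hx f' (MvPolynomial.mem_vanishingIdeal_iff.mpr fun y hy ↦ ?_)
      obtain ⟨b, rfl⟩ := exists_mem_orbitCoset_iff.mp hy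
      refine (MvPolynomial.eval₂_comp (algebraMap K L) (δ + b • γ : Points φ K) f').symm.trans ?_
      exact (congrArg (algebraMap K L) (hf' _ ⟨b, rfl⟩)).trans (map_zero _)
  · rintro _ ⟨y, hy, rfl⟩
    rw [hVJ]
    intro f hf
    have e : ∀ z : Fin g → L, MvPolynomial.aeval z f =
        MvPolynomial.aeval z (MvPolynomial.map (algebraMap K L) f) := fun z ↦
      (MvPolynomial.aeval_map_algebraMap L z f).symm
    refine (e _).trans ((aeval_translatePoly_points (ι δ) y _).symm.trans (hy _ ?_))
    refine MvPolynomial.mem_vanishingIdeal_iff.mpr ?_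
    rintro _ ⟨b, rfl⟩
    refine (aeval_translatePoly_points (ι δ) _ _).trans ((e _).symm.trans ?_)
    refine MvPolynomial.mem_vanishingIdeal_iff.mp hf _ ⟨b, ?_⟩
    simp only [zero_add]
    rfl

end RationalOrbit

/-! ### Finite or full intersection on each coset, and the finite cover of Γ. -/

section Main

variable {Fq : Type*} [Field Fq] [Finite Fq] {K : Type*} [Field K] [Algebra Fq[X] K]
  {L : Type*} [Field L] [Algebra K L] {g : ℕ} {φ : Fin g → DrinfeldModule Fq K}

/-- A coset of `A γ` either meets `V` in finitely many points or is contained in it. -/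
lemma finite_or_forall_mem_rationalPoints {V : Set (Fin g → L)} (hV : IsAlgebraicSet K V)
    {γ : Points φ K} (hid : HasOrbitIdentity (Points.baseChange L φ γ)) (δ : Points φ K) :
    {b : Fq[X] | δ + b • γ ∈ rationalPoints φ V}.Finite ∨
      ∀ b : Fq[X], δ + b • γ ∈ rationalPoints φ V := by
  obtain ⟨I, rfl⟩ := hV
  refine or_iff_not_imp_left.mpr fun h b p hp ↦ ?_
  have e : ∀ b : Fq[X], (Points.baseChange L φ (δ + b • γ)) =
      Points.baseChange L φ δ + b • Points.baseChange L φ γ := fun b ↦ by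
    rw [map_add, map_smul]
  change MvPolynomial.aeval (Points.baseChange L φ (δ + b • γ) : Fin g → L) p = 0
  rw [e]
  refine hid.aeval_eq_zero _ p (Set.Infinite.mono (fun c hc ↦ ?_) h) b
  have := hc p hp
  change MvPolynomial.aeval (Points.baseChange L φ (δ + c • γ) : Fin g → L) p = 0 at this
  rwa [e] at this

variable {Γ : Submodule Fq[X] (Points φ K)}

/-- A finitely generated `φ`-submodule of rank one has a torsion-free cyclic submodule for whose
cosets the identity principle holds, and finitely many of these cosets cover it. -/
lemma exists_cyclic_cover [Algebra Fq[X] L] [IsScalarTower Fq[X] K L]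
    [Algebra.IsAlgebraic Fq[X] L] (hinj : Function.Injective (algebraMap Fq[X] L))
    (hfg : Γ.FG) (hrank : phiRank Fq Γ = 1) :
    ∃ γ ∈ Γ, γ ≠ 0 ∧ HasOrbitIdentity (Points.baseChange L φ γ) ∧
      ∃ (n : ℕ) (δ : Fin n → Points φ K), (∀ j, δ j ∈ Γ) ∧
        ∀ x ∈ Γ, ∃ j, ∃ b : Fq[X], x = δ j + b • γ := by
  have hr := rank_eq_one_of_phiRank_eq_one hrank
  have : Module.Finite Fq[X] Γ := Module.Finite.iff_fg.mpr hfg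
  -- Rank one provides a non-torsion point; its nonzero multiple `a • γ₀` is again non-torsion, so
  -- it still spans a submodule of finite index.
  obtain ⟨γ₀, hγ₀⟩ : ∃ γ₀ : Γ, ∀ a : Fq[X], a • γ₀ = 0 → a = 0 := by
    by_contra! h
    refine one_ne_zero (hr.symm.trans (rank_eq_zero_iff.mpr fun x ↦ ?_))
    obtain ⟨a, ha, ha0⟩ := h x
    exact ⟨a, ha0, ha⟩
  obtain ⟨a, ha, hid⟩ := exists_smul_eval_eq_zero_of_infinite hinj φ
    (Points.baseChange L φ (γ₀ : Points φ K))
  have hγ : ∀ b : Fq[X], b • a • γ₀ = 0 → b = 0 := fun b hb ↦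
    (mul_eq_zero.mp (hγ₀ _ ((mul_smul b a γ₀).trans hb))).resolve_right ha
  have hfin := finite_quotient_span_singleton_of_rank_eq_one hr hγ
  obtain ⟨n, ⟨e⟩⟩ := Finite.exists_equiv_fin (Γ ⧸ Submodule.span Fq[X] {a • γ₀})
  refine ⟨((a • γ₀ : Γ) : Points φ K), (a • γ₀).2, fun h ↦ ?_, ?_, n,
    fun j ↦ ((e.symm j).out : Γ), fun j ↦ (Quotient.out (e.symm j)).2, fun x hx ↦ ?_⟩
  · exact one_ne_zero (hγ 1 (by rw [one_smul]; exact Subtype.ext h))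
  · intro δ f
    rw [Submodule.coe_smul, map_smul]
    exact hid δ f
  · refine ⟨e (Submodule.Quotient.mk ⟨x, hx⟩), ?_⟩
    simp only [e.symm_apply_apply]
    obtain ⟨b, hb⟩ := Submodule.mem_span_singleton.mp ((Submodule.Quotient.eq _).mp
      (Quotient.out_eq (Submodule.Quotient.mk ⟨x, hx⟩ :
        Γ ⧸ Submodule.span Fq[X] {a • γ₀})).symm)
    refine ⟨b, ?_⟩
    have := congrArg Subtype.val hb
    exact (eq_add_of_sub_eq' this.symm)

end Main

end

end DrinfeldML

theorem theorem4p1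
    {Fq : Type*} [Field Fq] [Finite Fq]
    {K : Type*} [Field K] [Algebra Fq[X] K] [Algebra (RatFunc Fq) K]
    [IsScalarTower Fq[X] (RatFunc Fq) K] [FiniteDimensional (RatFunc Fq) K]
    {Kbar : Type*} [Field Kbar] [Algebra K Kbar] [IsAlgClosure K Kbar]
    {g : ℕ} (φ : Fin g → DrinfeldModule Fq K)
    (V : Set (Fin g → Kbar)) (hV : IsAlgebraicSet K V)
    (Γ : Submodule Fq[X] (Points φ K)) (hfg : Γ.FG) (hrank : phiRank Fq Γ = 1) :
    IsFiniteUnionOfCosets Γ (rationalPoints φ V ∩ (Γ : Set (Points φ K))) ∧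
    (IsIrreducibleCurve K V → ¬ IsTranslateOfAlgebraicSubmodule φ V →
      (rationalPoints φ V ∩ (Γ : Set (Points φ K))).Finite) := by
  let _ : Algebra Fq[X] Kbar := ((algebraMap K Kbar).comp (algebraMap Fq[X] K)).toAlgebra
  have : IsScalarTower Fq[X] K Kbar := IsScalarTower.of_algebraMap_eq fun _ ↦ rfl
  have hinj : Function.Injective (algebraMap Fq[X] K) := by
    rw [IsScalarTower.algebraMap_eq Fq[X] (RatFunc Fq) K]
    exact (algebraMap (RatFunc Fq) K).injective.comp (IsFractionRing.injective Fq[X] (RatFunc Fq))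
  have : Algebra.IsAlgebraic Fq[X] K :=
    (IsFractionRing.comap_isAlgebraic_iff (A := Fq[X]) (K := RatFunc Fq) (C := K)).mpr inferInstance
  have : Algebra.IsAlgebraic K Kbar := IsAlgClosure.isAlgebraic
  have : FaithfulSMul Fq[X] K := (faithfulSMul_iff_algebraMap_injective _ _).mpr hinj
  have : Algebra.IsAlgebraic Fq[X] Kbar := Algebra.IsAlgebraic.trans Fq[X] K Kbar
  obtain ⟨γ, hγΓ, hγ, hid, n, δ, hδΓ, hcover⟩ := exists_cyclic_cover (L := Kbar)
    ((algebraMap K Kbar).injective.comp hinj) hfg hrank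
  let S : Fin n → Set (Points φ K) := fun j ↦
    (fun b : Fq[X] ↦ δ j + b • γ) '' {b | δ j + b • γ ∈ rationalPoints φ V}
  have hmem : ∀ j, ∀ b : Fq[X], δ j + b • γ ∈ Γ := fun j b ↦
    Γ.add_mem (hδΓ j) (Γ.smul_mem b hγΓ)
  have hS : rationalPoints φ V ∩ (Γ : Set (Points φ K)) = ⋃ j, S j := by
    ext x
    rw [Set.mem_iUnion]
    constructor
    · rintro ⟨hxV, hxΓ⟩
      obtain ⟨j, b, rfl⟩ := hcover x hxΓ
      exact ⟨j, b, hxV, rfl⟩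
    · rintro ⟨j, b, hb, rfl⟩
      exact ⟨hb, hmem j b⟩
  rw [hS]
  refine ⟨IsFiniteUnionOfCosets.iUnion fun j ↦ ?_, fun hcurve hnot ↦ Set.finite_iUnion fun j ↦ ?_⟩
  -- A finite intersection is a union of cosets of the zero module; otherwise the whole coset of `A
  -- γ` lies in `V`.
  · rcases finite_or_forall_mem_rationalPoints hV hid (δ j) with h | h
    · refine IsFiniteUnionOfCosets.of_finite (h.image _) ?_
      rintro _ ⟨b, -, rfl⟩
      exact hmem j b
    · have hSj : S j = (fun y ↦ δ j + y) '' (Submodule.span Fq[X] {γ} : Set (Points φ K)) := by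
        ext x
        constructor
        · rintro ⟨b, -, rfl⟩
          exact ⟨b • γ, Submodule.smul_mem _ b (Submodule.mem_span_singleton_self γ), rfl⟩
        · rintro ⟨y, hy, rfl⟩
          obtain ⟨b, rfl⟩ := Submodule.mem_span_singleton.mp hy
          exact ⟨b, h b, rfl⟩
      rw [hSj]
      exact IsFiniteUnionOfCosets.of_coset (hδΓ j)
        ((Submodule.span_singleton_le_iff_mem _ _).mpr hγΓ)
  · rcases finite_or_forall_mem_rationalPoints hV hid (δ j) with h | h
    · exact h.image _
    · exact absurd (isTranslate_of_orbit_subset hcurve hγ hid h) hnot
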